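/- Let $\mathbf{Top}$ be the category of compactly generated spaces (with its limits), and let $\mathbf{Cat}_{\mathbf{Top}}$ be the category of small categories enriched over $\mathbf{Top}$ ("topological categories") and continuous functors. For a topological category $C$, let $\pi_0C$ be the category with the objects of $C$ and with morphisms the path components of the mapping spaces of $C$; a morphism of $C$ is a *weak equivalence* if it is invertible in $\pi_0C$. In the model category $\mathbf{Cat}_{\mathbf{Top}}$, a functor $F:C\to D$ is a *weak equivalence* (Dwyer–Kan equivalence) if all maps $\mathrm{Map}_C(x,y)\to\mathrm{Map}_D(Fx,Fy)$ are weak homotopy equivalences and $\pi_0F$ is an equivalence of categories; it is a *fibration* if all these maps are Serre fibrations and, for every object $a$ of $C$ and every weak equivalence $e:Fa\to b$ in $D$, there is a weak equivalence $d:a\to a'$ in $C$ with $Fa'=b$ and $Fd=e$. For a space $X$, let $\mathcal M(X)$ be the space of Moore paths, i.e. of pairs $(\alpha,r)\in X^{\mathbb R_{\ge0}}\times\mathbb R_{\ge 0}$ with $\alpha(s)=\alpha(r)$ for all $s\ge r$, and let $\delta_-(\alpha,r)=\alpha(0)$, $\delta_+(\alpha,r)=\alpha(r)$. For a topological category $C$,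 let $\mathcal P(C)$ be the topological category whose objects are the weak equivalences $a:x\to y$ of $C$, and whose morphisms from $a:x\to y$ to $b:x'\to y'$ are the triples $(f,g,\alpha)$ with $f\in\mathrm{Map}_C(x,x')$, $g\in\mathrm{Map}_C(y,y')$ and $\alpha\in\mathcal M(\mathrm{Map}_C(x,y'))$ a Moore path from $g\circ a$ to $b\circ f$, topologized as the corresponding subspace of the product in $\mathbf{Top}$. The composite of $(f,g,\alpha)$ and $(f',g',\beta)$ is $(f'f,\,g'g,\,\gamma)$, where $\gamma$ is the concatenation of $g'\circ\alpha$ followed by $\beta\circ f$; identities are $(\mathrm{id},\mathrm{id},\text{constant path of length }0)$. This defines a functor $\mathcal P:\mathbf{Cat}_{\mathbf{Top}}\to\mathbf{Cat}_{\mathbf{Top}}$, with natural transformations $i:C\to\mathcal P(C)$, $x\mapsto(\mathrm{id}:x\to x)$, $f\mapsto(f,f,\text{constant path of length }0)$, and $(ev_s,ev_t):\mathcal P(C)\to C\times C$, $(a:x\to y)\mapsto(x,y)$, $(f,g,\alpha)\mapsto(f,g)$. **Theorem.** $\mathcal P(C)$ is a functorial path object in $\mathbf{Cat}_{\mathbf{Top}}$.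 That is, the composite $C\xrightarrow{\,i\,}\mathcal P(C)\xrightarrow{(ev_s,ev_t)}C\times C$ is the diagonal, naturally in $C$, and for every topological category $C$: 1. for all objects $a:x\to y$ and $b:x'\to y'$ of $\mathcal P(C)$, the square $$\begin{array}{ccc}\mathrm{Map}_{\mathcal P(C)}(a,b)&\longrightarrow&\mathcal M(\mathrm{Map}_C(x,y'))\\ {\scriptstyle(ev_s,ev_t)}\downarrow&&\downarrow{\scriptstyle(\delta_-,\delta_+)}\\ \mathrm{Map}_C(x,x')\times\mathrm{Map}_C(y,y')&\longrightarrow&\mathrm{Map}_C(x,y')\times\mathrm{Map}_C(x,y')\end{array}$$ with lower map $(f,g)\mapsto(g\circ a,\,b\circ f)$ is a pullback in $\mathbf{Top}$; 2. $i:C\to\mathcal P(C)$ is a Dwyer–Kan equivalence; 3. $(ev_s,ev_t):\mathcal P(C)\to C\times C$ is a fibration. Hence $C\to\mathcal P(C)\rightrightarrows C$ is a good path object for $C$. -/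

import Mathlib

open CategoryTheory Topology HomotopicalAlgebra
open scoped unitInterval NNReal

universe u v w

noncomputable section

/-! ### Compactly generated spaces -/

/-- The family of all compact Hausdorff spaces (in the universe `u`). -/
abbrev CompTest : CompHaus.{u} → Type u := fun S => S

/-- The compactly generated space associated with a space `Y`: the same points, with the final
topology with respect to all continuous maps from compact Hausdorff spaces to `Y`. It is the
coreflection of `Y` into compactly generated spaces, so limits of compactly generated
spaces are obtained by applying it to the limits in topological spaces. -/
abbrev KSpace (Y : Type u) [TopologicalSpace Y] : Type u :=
  WithGeneratedByTopology CompTest.{u} Y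

/-- The identity map from a space with its compactly generated topology to the space itself. -/
abbrev unK {Y : Type u} [TopologicalSpace Y] : KSpace Y ≃ Y := WithGeneratedByTopology.equiv

/-- The inverse of `unK`. -/
abbrev toK {Y : Type u} [TopologicalSpace Y] : Y ≃ KSpace Y := WithGeneratedByTopology.equiv.symm

theorem isGeneratedBy_of_uCompactlyGenerated (Y : Type v) [TopologicalSpace Y]
    [UCompactlyGeneratedSpace.{u} Y] : IsGeneratedBy CompTest.{u} Y where
  continuous_equiv_symm := by
    refine continuous_from_uCompactlyGeneratedSpace.{u} _ fun S g => ?_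
    rw [IsGeneratedBy.equiv_symm_comp_continuous_iff]
    exact g.continuous

instance KSpace.compactlyGeneratedSpace (Y : Type u) [TopologicalSpace Y] :
    CompactlyGeneratedSpace (KSpace Y) := by
  refine uCompactlyGeneratedSpace_of_continuous_maps fun f hf => ?_
  rw [WithGeneratedByTopology.continuous_from_iff]
  intro S g
  refine hf S ⟨toK ∘ g, ?_⟩
  rw [IsGeneratedBy.equiv_symm_comp_continuous_iff]
  exact g.continuous

theorem continuous_unK {Y : Type u} [TopologicalSpace Y] : Continuous (unK (Y := Y)) :=
  WithGeneratedByTopology.continuous_equiv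

instance (S : CompHaus.{u}) : UCompactlyGeneratedSpace.{u} S :=
  uCompactlyGeneratedSpace_of_continuous_maps fun _ hf => hf S (ContinuousMap.id S)

theorem uCompactlyGenerated_prod (K : Type u) [TopologicalSpace K] [CompactSpace K] [T2Space K] :
    UCompactlyGeneratedSpace.{u} (K × ℝ≥0) :=
  inferInstanceAs (CompactlyGeneratedSpace (K × ℝ≥0))

instance (S : CompHaus.{u}) : UCompactlyGeneratedSpace.{u} (S × ℝ≥0) :=
  uCompactlyGenerated_prod S

/-- Continuity of a map into the compactly generated space associated with `Y`. -/
theorem continuous_toK_comp {Z : Type v} [TopologicalSpace Z] [UCompactlyGeneratedSpace.{u} Z]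
    {Y : Type u} [TopologicalSpace Y] {f : Z → Y} (hf : Continuous f) :
    Continuous fun z => toK (f z) := by
  have := isGeneratedBy_of_uCompactlyGenerated.{u} Z
  exact (IsGeneratedBy.equiv_symm_comp_continuous_iff (X := CompTest.{u}) f).2 hf

/-- A map out of the compactly generated space associated with `Y` is continuous as soon as its
restrictions along all test maps are. -/
theorem continuous_of_test {Y : Type u} [TopologicalSpace Y] {Z : Type v} [TopologicalSpace Z]
    {f : KSpace Y → Z}
    (hf : ∀ (S : CompHaus.{u}) (g : C(S, Y)), Continuous fun s => f (toK (g s))) :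
    Continuous f :=
  (WithGeneratedByTopology.continuous_from_iff f).2 fun S g => hf S g

/-! ### Homotopy theory of spaces -/

/-- The map induced on generalized loops by a continuous map. -/
def GenLoop.push {X : Type v} {Y : Type w} [TopologicalSpace X] [TopologicalSpace Y]
    (f : C(X, Y)) (n : ℕ) (x : X) (p : GenLoop (Fin n) X x) : GenLoop (Fin n) Y (f x) :=
  ⟨f.comp p.1, fun y hy => congrArg f (p.2 y hy)⟩

/-- The map `π_n(X, x) → π_n(Y, f x)` induced by a continuous map `f`. -/
def HomotopyGroup.push {X : Type v} {Y : Type w} [TopologicalSpace X] [TopologicalSpace Y]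
    (f : C(X, Y)) (n : ℕ) (x : X) : HomotopyGroup.Pi n X x → HomotopyGroup.Pi n Y (f x) :=
  Quotient.map (GenLoop.push f n x) fun _ _ h => h.comp_continuousMap f

/-- The map induced on sets of path components by a continuous map. -/
def ZerothHomotopy.push {X : Type v} {Y : Type w} [TopologicalSpace X] [TopologicalSpace Y]
    (f : C(X, Y)) : ZerothHomotopy X → ZerothHomotopy Y :=
  Quotient.map f fun _ _ h => h.map f.continuous

/-- Weak homotopy equivalences. -/
def IsWeakHomotopyEquiv {X : Type v} {Y : Type w} [TopologicalSpace X] [TopologicalSpace Y]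
    (f : C(X, Y)) : Prop :=
  Function.Bijective (ZerothHomotopy.push f) ∧
    ∀ (n : ℕ) (x : X), Function.Bijective (HomotopyGroup.push f (n + 1) x)

/-- Serre fibrations: maps with the homotopy lifting property for all cubes. -/
def IsSerreFibration {E : Type v} {B : Type w} [TopologicalSpace E] [TopologicalSpace B]
    (p : C(E, B)) : Prop :=
  ∀ (n : ℕ) (f : C(Fin n → I, E)) (H : C((Fin n → I) × I, B)),
    (∀ x, H (x, 0) = p (f x)) →
      ∃ L : C((Fin n → I) × I, E), (∀ x, L (x, 0) = f x) ∧ ∀ z, p (L z) = H z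

/-! ### Moore paths -/

/-- Moore paths in `X`: pairs of a map `α : ℝ≥0 → X` and a length `r` such that `α` is
constant on `[r, ∞)`. They carry the subspace topology of `C(ℝ≥0, X) × ℝ≥0`, where `C(ℝ≥0, X)`
has the compact-open topology; the Moore path space `𝓜(X)` of a compactly generated
space `X` is `KSpace (MoorePath X)`. -/
def MoorePath (X : Type v) [TopologicalSpace X] : Type v :=
  {p : C(ℝ≥0, X) × ℝ≥0 // ∀ s, p.2 ≤ s → p.1 s = p.1 p.2}

namespace MoorePath

variable {X : Type v} [TopologicalSpace X] {Y : Type w} [TopologicalSpace Y]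

instance : TopologicalSpace (MoorePath X) :=
  inferInstanceAs (TopologicalSpace {p : C(ℝ≥0, X) × ℝ≥0 // ∀ s, p.2 ≤ s → p.1 s = p.1 p.2})

/-- The underlying map of a Moore path. -/
def path (α : MoorePath X) : C(ℝ≥0, X) := α.1.1

/-- The length of a Moore path. -/
def length (α : MoorePath X) : ℝ≥0 := α.1.2

/-- The starting point `δ₋(α, r) = α(0)`. -/
def source (α : MoorePath X) : X := α.path 0

/-- The end point `δ₊(α, r) = α(r)`. -/
def target (α : MoorePath X) : X := α.path α.length

theorem path_eq_target (α : MoorePath X) {s : ℝ≥0} (h : α.length ≤ s) : α.path s = α.target :=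
  α.2 s h

@[ext]
theorem ext {α β : MoorePath X} (h : ∀ t, α.path t = β.path t) (hl : α.length = β.length) :
    α = β :=
  Subtype.ext (Prod.ext (ContinuousMap.ext h) hl)

/-- The constant Moore path of length `0`. -/
def const (x : X) : MoorePath X := ⟨(ContinuousMap.const _ x, 0), fun _ _ => rfl⟩

/-- The image of a Moore path under a continuous map. -/
def map (f : C(X, Y)) (α : MoorePath X) : MoorePath Y :=
  ⟨(f.comp α.path, α.length), fun s hs => congrArg f (α.2 s hs)⟩

theorem continuous_iff {Z : Type*} [TopologicalSpace Z] {f : Z → MoorePath X} :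
    Continuous f ↔ (Continuous fun p : Z × ℝ≥0 => (f p.1).path p.2) ∧
      Continuous fun z => (f z).length := by
  constructor
  · intro h
    have h1 : Continuous fun z => (f z).path :=
      continuous_fst.comp (continuous_subtype_val.comp h)
    exact ⟨ContinuousMap.continuous_uncurry_of_continuous ⟨_, h1⟩,
      continuous_snd.comp (continuous_subtype_val.comp h)⟩
  · rintro ⟨h1, h2⟩
    exact Continuous.subtype_mk
      ((ContinuousMap.continuous_of_continuous_uncurry (fun z => (f z).path) h1).prodMk h2) _

theorem continuous_source : Continuous (source : MoorePath X → X) :=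
  ((continuous_iff.1 continuous_id).1).comp (continuous_id.prodMk continuous_const)

theorem continuous_target : Continuous (target : MoorePath X → X) :=
  ((continuous_iff.1 continuous_id).1).comp
    (continuous_id.prodMk (continuous_iff.1 continuous_id).2)

theorem continuous_map (f : C(X, Y)) : Continuous (map f) :=
  continuous_iff.2 ⟨f.continuous.comp (continuous_iff.1 continuous_id).1,
    (continuous_iff.1 continuous_id).2⟩

theorem continuous_const : Continuous (const : X → MoorePath X) :=
  continuous_iff.2 ⟨continuous_fst, _root_.continuous_const⟩

/-- The underlying function of the concatenation: first `α`, then `β`. -/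
def concatFun (α β : MoorePath X) (t : ℝ≥0) : X :=
  if t ≤ α.length then α.path t else β.path (t - α.length)

theorem continuous_concatFun {Z : Type*} [TopologicalSpace Z] {f g : Z → MoorePath X}
    (hf : Continuous f) (hg : Continuous g) (h : ∀ z, (f z).target = (g z).source) :
    Continuous fun p : Z × ℝ≥0 => concatFun (f p.1) (g p.1) p.2 := by
  have hf' := continuous_iff.1 hf
  have hg' := continuous_iff.1 hg
  have hl : Continuous fun p : Z × ℝ≥0 => (f p.1).length := hf'.2.comp continuous_fst
  refine Continuous.if_le hf'.1 (hg'.1.comp (continuous_fst.prodMk (continuous_snd.sub hl)))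
    continuous_snd hl ?_
  rintro ⟨z, t⟩ (ht : t = (f z).length)
  subst ht
  simpa [source, target] using h z

/-- The strictly associative concatenation: first `α`, then `β`; the length is the sum of the
lengths. -/
def concat (α β : MoorePath X) (h : α.target = β.source) : MoorePath X :=
  ⟨(⟨concatFun α β, (continuous_concatFun (Z := Unit) (f := fun _ => α) (g := fun _ => β)
      _root_.continuous_const _root_.continuous_const fun _ => h).comp
      (_root_.continuous_const.prodMk continuous_id : Continuous fun t : ℝ≥0 => (((), t) : Unit × ℝ≥0))⟩,
    α.length + β.length), by
    have key : ∀ s, α.length + β.length ≤ s → concatFun α β s = β.target := by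
      intro s hs
      unfold concatFun
      split_ifs with h1
      · have hb : β.length = 0 := by
          have : α.length + β.length ≤ α.length + 0 := by simpa using hs.trans h1
          exact le_antisymm (le_of_add_le_add_left this) bot_le
        have hs' : s = α.length := le_antisymm h1 (le_trans (by simp) hs)
        subst hs'
        have : β.target = β.source := by simp [target, source, hb]
        rw [this]
        exact h
      · exact β.path_eq_target (le_tsub_of_add_le_left hs)
    intro s hs
    exact (key s hs).trans (key _ le_rfl).symm⟩

variable (α β γ : MoorePath X)

variable {α β} in
theorem concat_congr {α' β' : MoorePath X} (h : α.target = β.source) (ha : α = α')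
    (hb : β = β') : concat α β h = concat α' β' (by rw [← ha, ← hb]; exact h) := by
  subst ha hb
  rfl

theorem concat_path (h : α.target = β.source) (t : ℝ≥0) :
    (concat α β h).path t = concatFun α β t := rfl

theorem concat_length (h : α.target = β.source) :
    (concat α β h).length = α.length + β.length := rfl

theorem concat_source (h : α.target = β.source) : (concat α β h).source = α.source := by
  simp [source, concat_path, concatFun]

theorem concat_target (h : α.target = β.source) : (concat α β h).target = β.target := by
  rw [target, concat_path, concat_length, concatFun]
  split_ifs with h1
  · have hb : β.length = 0 := by
      have : α.length + β.length ≤ α.length + 0 := by simpa using h1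
      exact le_antisymm (le_of_add_le_add_left this) bot_le
    rw [target, hb, add_zero]
    exact h
  · simp [target]

theorem const_concat (x : X) (h : (const x).target = α.source) : concat (const x) α h = α := by
  ext t
  · rw [concat_path, concatFun]
    split_ifs with h1
    · have : t = 0 := le_antisymm h1 bot_le
      subst this
      exact h
    · simp [const, length]
  · exact zero_add _

theorem concat_const (x : X) (h : α.target = (const x).source) : concat α (const x) h = α := by
  ext t
  · rw [concat_path, concatFun]
    split_ifs with h1
    · rfl
    · rw [α.path_eq_target (le_of_not_ge h1)]
      exact h.symm
  · exact add_zero _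

theorem concat_assoc (h1 : α.target = β.source) (h2 : β.target = γ.source) :
    concat (concat α β h1) γ ((concat_target α β h1).trans h2) =
      concat α (concat β γ h2) (h1.trans (concat_source β γ h2).symm) := by
  ext t
  · simp only [concat_path, concatFun, concat_length]
    by_cases ha : t ≤ α.length
    · simp [ha, le_add_right ha]
    · have hlt := lt_of_not_ge ha
      simp only [ha, if_false, tsub_le_iff_left, tsub_tsub]
  · simp [concat_length, add_assoc]

theorem map_concat (f : C(X, Y)) (h : α.target = β.source) :
    map f (concat α β h) = concat (map f α) (map f β) (congrArg f h) := by
  ext t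
  · change f (concatFun α β t) = concatFun (map f α) (map f β) t
    unfold concatFun
    split_ifs with h1 h2 h2
    · rfl
    · exact absurd h1 h2
    · exact absurd h2 h1
    · rfl
  · rfl

theorem map_const (f : C(X, Y)) (x : X) : map f (const x) = const (f x) := rfl

theorem continuous_concat {Z : Type*} [TopologicalSpace Z] {f g : Z → MoorePath X}
    (hf : Continuous f) (hg : Continuous g) (h : ∀ z, (f z).target = (g z).source) :
    Continuous fun z => concat (f z) (g z) (h z) :=
  continuous_iff.2 ⟨continuous_concatFun hf hg h,
    (continuous_iff.1 hf).2.add (continuous_iff.1 hg).2⟩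

end MoorePath

/-! ### Small topological categories -/

/-- Small topological categories: small categories enriched over compactly generated spaces.
The composition is continuous on the product in compactly generated spaces. -/
structure CatTop : Type (u + 1) where
  /-- The set of objects. -/
  Obj : Type u
  [category : Category.{u} Obj]
  [topology : ∀ x y : Obj, TopologicalSpace (x ⟶ y)]
  [compactlyGenerated : ∀ x y : Obj, CompactlyGeneratedSpace (x ⟶ y)]
  continuous_comp : ∀ x y z : Obj,
    Continuous fun p : KSpace ((x ⟶ y) × (y ⟶ z)) => (unK p).1 ≫ (unK p).2

namespace CatTop

attribute [instance] category topology compactlyGenerated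

theorem continuous_comp_of_continuous (C : CatTop.{u}) {Z : Type v} [TopologicalSpace Z]
    [UCompactlyGeneratedSpace.{u} Z] {x y z : C.Obj} {f : Z → (x ⟶ y)} {g : Z → (y ⟶ z)}
    (hf : Continuous f) (hg : Continuous g) : Continuous fun t => f t ≫ g t :=
  (C.continuous_comp x y z).comp (continuous_toK_comp (hf.prodMk hg))

/-- Precomposition `a^* : Map(y, z) → Map(x, z)`. -/
def precomp (C : CatTop.{u}) {x y : C.Obj} (a : x ⟶ y) (z : C.Obj) : C(y ⟶ z, x ⟶ z) :=
  ⟨fun g => a ≫ g, C.continuous_comp_of_continuous continuous_const continuous_id⟩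

/-- Postcomposition `b_* : Map(x, y) → Map(x, z)`. -/
def postcomp (C : CatTop.{u}) (x : C.Obj) {y z : C.Obj} (b : y ⟶ z) : C(x ⟶ y, x ⟶ z) :=
  ⟨fun f => f ≫ b, C.continuous_comp_of_continuous continuous_id continuous_const⟩

/-- Morphisms of topological categories: functors which are continuous on mapping spaces. -/
@[ext]
structure Hom (C D : CatTop.{u}) where
  /-- The underlying functor. -/
  functor : C.Obj ⥤ D.Obj
  continuous_map : ∀ x y : C.Obj, Continuous fun f : x ⟶ y => functor.map f

instance : Category CatTop.{u} where
  Hom := Hom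
  id C := ⟨𝟭 C.Obj, fun _ _ => continuous_id⟩
  comp F G := ⟨F.functor ⋙ G.functor, fun _ _ => (G.continuous_map _ _).comp (F.continuous_map _ _)⟩

@[ext]
theorem hom_ext {C D : CatTop.{u}} {F G : C ⟶ D} (h : F.functor = G.functor) : F = G :=
  Hom.ext h

@[simp] theorem id_functor (C : CatTop.{u}) : Hom.functor (𝟙 C) = 𝟭 C.Obj := rfl

@[simp] theorem comp_functor {C D E : CatTop.{u}} (F : C ⟶ D) (G : D ⟶ E) :
    (F ≫ G).functor = F.functor ⋙ G.functor := rfl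

/-- The continuous map induced on mapping spaces by a morphism of topological categories. -/
def Hom.mapSpace {C D : CatTop.{u}} (F : Hom C D) (x y : C.Obj) :
    C(x ⟶ y, F.functor.obj x ⟶ F.functor.obj y) :=
  ⟨fun f => F.functor.map f, F.continuous_map x y⟩

/-! ### The homotopy category `π₀ C` -/

/-- Two morphisms are identified in `π₀ C` when they lie in the same path component of the
mapping space. -/
def homotopyRel (C : CatTop.{u}) : HomRel C.Obj := fun _ _ f g => Joined f g

instance (C : CatTop.{u}) : Congruence C.homotopyRel where
  equivalence := ⟨Joined.refl, Joined.symm, Joined.trans⟩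
  comp_left f _ _ h := Joined.map h (C.precomp f _).continuous
  comp_right g h := Joined.map h (C.postcomp _ g).continuous

/-- The category `π₀ C`: its objects are those of `C`, its morphisms are the path components
of the mapping spaces of `C`. -/
abbrev Ho (C : CatTop.{u}) : Type u := CategoryTheory.Quotient C.homotopyRel

/-- The canonical functor `C ⥤ π₀ C`. -/
abbrev toHo (C : CatTop.{u}) : C.Obj ⥤ C.Ho := CategoryTheory.Quotient.functor C.homotopyRel

/-- The functor `π₀ C ⥤ π₀ D` induced by a morphism of topological categories. -/
def Hom.ho {C D : CatTop.{u}} (F : Hom C D) : C.Ho ⥤ D.Ho :=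
  CategoryTheory.Quotient.lift C.homotopyRel (F.functor ⋙ D.toHo) fun _ _ _ _ h =>
    CategoryTheory.Quotient.sound _ (Joined.map h (F.continuous_map _ _))

/-- Weak equivalences in a topological category: morphisms which become invertible
in `π₀ C`. -/
def IsWeakEquiv (C : CatTop.{u}) {x y : C.Obj} (a : x ⟶ y) : Prop := IsIso (C.toHo.map a)

theorem isWeakEquiv_id (C : CatTop.{u}) (x : C.Obj) : C.IsWeakEquiv (𝟙 x) := by
  unfold IsWeakEquiv
  infer_instance

theorem IsWeakEquiv.map {C D : CatTop.{u}} (F : Hom C D) {x y : C.Obj} {a : x ⟶ y}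
    (ha : C.IsWeakEquiv a) : D.IsWeakEquiv (F.functor.map a) := by
  have : IsIso (C.toHo.map a) := ha
  exact inferInstanceAs (IsIso (F.ho.map (C.toHo.map a)))

/-! ### Weak equivalences and fibrations of topological categories -/

/-- Dwyer–Kan equivalences: weak homotopy equivalences on all mapping spaces, inducing an
equivalence of categories `π₀ C ⥤ π₀ D`. -/
def IsDwyerKanEquiv {C D : CatTop.{u}} (F : Hom C D) : Prop :=
  (∀ x y : C.Obj, IsWeakHomotopyEquiv (F.mapSpace x y)) ∧ F.ho.IsEquivalence

/-- Fibrations: Serre fibrations on all mapping spaces, such that every weak equivalence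
`e : F a ⟶ b` is the image of a weak equivalence `d : a ⟶ a'`. -/
def IsFibration {C D : CatTop.{u}} (F : Hom C D) : Prop :=
  (∀ x y : C.Obj, IsSerreFibration (F.mapSpace x y)) ∧
    ∀ (a : C.Obj) (b : D.Obj) (e : F.functor.obj a ⟶ b), D.IsWeakEquiv e →
      ∃ (a' : C.Obj) (d : a ⟶ a') (h : F.functor.obj a' = b),
        C.IsWeakEquiv d ∧ F.functor.map d ≫ eqToHom h = e

/-- The weak equivalences of the model structure on `CatTop`. -/
instance : CategoryWithWeakEquivalences CatTop.{u} where
  weakEquivalences := fun _ _ F => IsDwyerKanEquiv F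

/-- The fibrations of the model structure on `CatTop`. -/
instance : CategoryWithFibrations CatTop.{u} where
  fibrations := fun _ _ F => IsFibration F

/-! ### Products -/

/-- The objects of the product of two topological categories. -/
structure ProdObj (C D : CatTop.{u}) : Type u where
  /-- The first component. -/
  fst : C.Obj
  /-- The second component. -/
  snd : D.Obj

instance (C D : CatTop.{u}) : Category (ProdObj C D) where
  Hom p q := KSpace ((p.fst ⟶ q.fst) × (p.snd ⟶ q.snd))
  id p := toK (𝟙 p.fst, 𝟙 p.snd)
  comp f g := toK ((unK f).1 ≫ (unK g).1, (unK f).2 ≫ (unK g).2)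
  id_comp f := congrArg toK (Prod.ext (Category.id_comp (unK f).1) (Category.id_comp (unK f).2))
  comp_id f := congrArg toK (Prod.ext (Category.comp_id (unK f).1) (Category.comp_id (unK f).2))
  assoc f g h := congrArg toK (Prod.ext (Category.assoc (unK f).1 (unK g).1 (unK h).1)
    (Category.assoc (unK f).2 (unK g).2 (unK h).2))

instance {C D : CatTop.{u}} (p q : ProdObj C D) : TopologicalSpace (p ⟶ q) :=
  inferInstanceAs (TopologicalSpace (KSpace ((p.fst ⟶ q.fst) × (p.snd ⟶ q.snd))))

instance {C D : CatTop.{u}} (p q : ProdObj C D) : CompactlyGeneratedSpace (p ⟶ q) :=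
  inferInstanceAs (CompactlyGeneratedSpace (KSpace ((p.fst ⟶ q.fst) × (p.snd ⟶ q.snd))))

/-- The product of two topological categories; its mapping spaces are the products of the
mapping spaces in compactly generated spaces. -/
def prod (C D : CatTop.{u}) : CatTop.{u} where
  Obj := ProdObj C D
  continuous_comp p q r := by
    refine continuous_of_test fun S g => ?_
    have h1 := continuous_unK.comp (continuous_fst.comp g.continuous)
    have h2 := continuous_unK.comp (continuous_snd.comp g.continuous)
    exact continuous_toK_comp
      ((C.continuous_comp_of_continuous (continuous_fst.comp h1) (continuous_fst.comp h2)).prodMk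
        (D.continuous_comp_of_continuous (continuous_snd.comp h1) (continuous_snd.comp h2)))

/-- The first projection. -/
def prodFst (C D : CatTop.{u}) : C.prod D ⟶ C where
  functor := { obj := fun p => ProdObj.fst p, map := fun f => (unK f).1 }
  continuous_map _ _ := continuous_fst.comp continuous_unK

/-- The second projection. -/
def prodSnd (C D : CatTop.{u}) : C.prod D ⟶ D where
  functor := { obj := fun p => ProdObj.snd p, map := fun f => (unK f).2 }
  continuous_map _ _ := continuous_snd.comp continuous_unK

/-- The morphism `(F, G) : E ⟶ C × D`. -/
def prodLift {C D E : CatTop.{u}} (F : E ⟶ C) (G : E ⟶ D) : E ⟶ C.prod D where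
  functor :=
    { obj := fun x => (⟨F.functor.obj x, G.functor.obj x⟩ : ProdObj C D)
      map := fun f => toK (F.functor.map f, G.functor.map f)
      map_id := fun x => congrArg toK (Prod.ext (F.functor.map_id x) (G.functor.map_id x))
      map_comp := fun f g =>
        congrArg toK (Prod.ext (F.functor.map_comp f g) (G.functor.map_comp f g)) }
  continuous_map x y := continuous_toK_comp ((F.continuous_map x y).prodMk (G.continuous_map x y))

/-- `C × D` is the categorical product of `C` and `D` in `CatTop`. -/
def prodIsLimit (C D : CatTop.{u}) :
    Limits.IsLimit (Limits.BinaryFan.mk (C.prodFst D) (C.prodSnd D)) :=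
  Limits.BinaryFan.isLimitMk (fun s => prodLift s.fst s.snd) (fun _ => rfl) (fun _ => rfl)
    (fun s m h1 h2 => by
      rw [← h1, ← h2]
      rfl)

instance : Limits.HasBinaryProducts CatTop.{u} :=
  have : ∀ C D : CatTop.{u}, Limits.HasBinaryProduct C D := fun C D =>
    ⟨⟨⟨_, prodIsLimit C D⟩⟩⟩
  Limits.hasBinaryProducts_of_hasLimit_pair _

/-- The functor `C ↦ C × C`. -/
def square : CatTop.{u} ⥤ CatTop.{u} where
  obj C := C.prod C
  map {C _} F := prodLift (C.prodFst C ≫ F) (C.prodSnd C ≫ F)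

/-- The diagonal `Δ : C ⟶ C × C`, as a natural transformation. -/
def diagonal : 𝟭 CatTop.{u} ⟶ square where
  app C := prodLift (𝟙 C) (𝟙 C)

/-! ### The categorical path object `P(C)` -/

/-- The objects of `P(C)`: weak equivalences `a : x ⟶ y` of `C`. -/
structure PathObj (C : CatTop.{u}) : Type u where
  /-- The source `x`. -/
  src : C.Obj
  /-- The target `y`. -/
  tgt : C.Obj
  /-- The morphism `a : x ⟶ y`. -/
  hom : src ⟶ tgt
  isWeakEquiv : C.IsWeakEquiv hom

variable {C D : CatTop.{u}}

/-- The action of a morphism of topological categories on the objects of `P(C)`. -/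
def PathObj.map (F : Hom C D) (a : C.PathObj) : D.PathObj :=
  ⟨F.functor.obj a.src, F.functor.obj a.tgt, F.functor.map a.hom, a.isWeakEquiv.map F⟩

/-- The morphisms from `a : x ⟶ y` to `b : x' ⟶ y'` in `P(C)`: triples of `f : x ⟶ x'`,
`g : y ⟶ y'` and a Moore path in `Map(x, y')` from `g ∘ a` to `b ∘ f`, with the
subspace topology. -/
def PathHom (a b : C.PathObj) : Type u :=
  {p : ((a.src ⟶ b.src) × (a.tgt ⟶ b.tgt)) × MoorePath (a.src ⟶ b.tgt) //
    p.2.source = a.hom ≫ p.1.2 ∧ p.2.target = p.1.1 ≫ b.hom}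

namespace PathHom

instance (a b : C.PathObj) : TopologicalSpace (PathHom a b) :=
  inferInstanceAs (TopologicalSpace
    {p : ((a.src ⟶ b.src) × (a.tgt ⟶ b.tgt)) × MoorePath (a.src ⟶ b.tgt) //
      p.2.source = a.hom ≫ p.1.2 ∧ p.2.target = p.1.1 ≫ b.hom})

variable {a b c d : C.PathObj}

/-- The component `f : x ⟶ x'`. -/
def fst (p : PathHom a b) : a.src ⟶ b.src := p.1.1.1

/-- The component `g : y ⟶ y'`. -/
def snd (p : PathHom a b) : a.tgt ⟶ b.tgt := p.1.1.2

/-- The Moore path from `g ∘ a` to `b ∘ f`. -/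
def moore (p : PathHom a b) : MoorePath (a.src ⟶ b.tgt) := p.1.2

theorem moore_source (p : PathHom a b) : p.moore.source = a.hom ≫ p.snd := p.2.1

theorem moore_target (p : PathHom a b) : p.moore.target = p.fst ≫ b.hom := p.2.2

@[ext]
theorem ext {p q : PathHom a b} (h1 : p.fst = q.fst) (h2 : p.snd = q.snd)
    (h3 : p.moore = q.moore) : p = q :=
  Subtype.ext (Prod.ext (Prod.ext h1 h2) h3)

/-- Constructor for morphisms of `P(C)`. -/
def mk (f : a.src ⟶ b.src) (g : a.tgt ⟶ b.tgt) (α : MoorePath (a.src ⟶ b.tgt))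
    (h1 : α.source = a.hom ≫ g) (h2 : α.target = f ≫ b.hom) : PathHom a b :=
  ⟨((f, g), α), h1, h2⟩

theorem continuous_iff {Z : Type*} [TopologicalSpace Z] {F : Z → PathHom a b} :
    Continuous F ↔ Continuous (fun z => (F z).fst) ∧ Continuous (fun z => (F z).snd) ∧
      Continuous fun z => (F z).moore := by
  constructor
  · intro h
    have h' := continuous_subtype_val.comp h
    exact ⟨_root_.continuous_fst.comp (_root_.continuous_fst.comp h'),
      _root_.continuous_snd.comp (_root_.continuous_fst.comp h'), _root_.continuous_snd.comp h'⟩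
  · rintro ⟨h1, h2, h3⟩
    exact Continuous.subtype_mk ((h1.prodMk h2).prodMk h3) _

theorem continuous_fst : Continuous (fst : PathHom a b → _) :=
  (continuous_iff.1 continuous_id).1

theorem continuous_snd : Continuous (snd : PathHom a b → _) :=
  (continuous_iff.1 continuous_id).2.1

theorem continuous_moore : Continuous (moore : PathHom a b → _) :=
  (continuous_iff.1 continuous_id).2.2

/-- The identity of `a : x ⟶ y`: the identities of `x` and `y` and the constant Moore path of
length `0`. -/
def id (a : C.PathObj) : PathHom a a :=
  mk (𝟙 _) (𝟙 _) (MoorePath.const a.hom) (Category.comp_id _).symm (Category.id_comp _).symm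

theorem comp_aux (p : PathHom a b) (q : PathHom b c) :
    (p.moore.map (C.postcomp a.src q.snd)).target =
      (q.moore.map (C.precomp p.fst c.tgt)).source := by
  change p.moore.target ≫ q.snd = p.fst ≫ q.moore.source
  rw [moore_target, moore_source, Category.assoc]

/-- The composition of `(f, g, α)` and `(f', g', β)` is `(f' ∘ f, g' ∘ g, γ)` where `γ` is
the concatenation of `g' ∘ α` followed by `β ∘ f`. -/
def comp (p : PathHom a b) (q : PathHom b c) : PathHom a c :=
  mk (p.fst ≫ q.fst) (p.snd ≫ q.snd)
    ((p.moore.map (C.postcomp a.src q.snd)).concat (q.moore.map (C.precomp p.fst c.tgt))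
      (comp_aux p q))
    (by
      rw [MoorePath.concat_source]
      change p.moore.source ≫ q.snd = _
      rw [moore_source, Category.assoc])
    (by
      rw [MoorePath.concat_target]
      change p.fst ≫ q.moore.target = _
      rw [moore_target, Category.assoc])

theorem id_comp (p : PathHom a b) : comp (id a) p = p := by
  refine ext (Category.id_comp p.fst) (Category.id_comp p.snd) ?_
  have h : (id a).moore.map (C.postcomp a.src p.snd) = MoorePath.const (a.hom ≫ p.snd) := rfl
  have h' : p.moore.map (C.precomp (id a).fst b.tgt) = p.moore :=
    MoorePath.ext (fun t => Category.id_comp (p.moore.path t)) rfl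
  exact (MoorePath.concat_congr (comp_aux (id a) p) h h').trans (MoorePath.const_concat _ _ _)

theorem comp_id (p : PathHom a b) : comp p (id b) = p := by
  refine ext (Category.comp_id p.fst) (Category.comp_id p.snd) ?_
  have h : (id b).moore.map (C.precomp p.fst b.tgt) = MoorePath.const (p.fst ≫ b.hom) := rfl
  have h' : p.moore.map (C.postcomp a.src (id b).snd) = p.moore :=
    MoorePath.ext (fun t => Category.comp_id (p.moore.path t)) rfl
  exact (MoorePath.concat_congr (comp_aux p (id b)) h' h).trans (MoorePath.concat_const _ _ _)

theorem assoc (p : PathHom a b) (q : PathHom b c) (r : PathHom c d) :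
    comp (comp p q) r = comp p (comp q r) := by
  refine ext (Category.assoc p.fst q.fst r.fst) (Category.assoc p.snd q.snd r.snd) ?_
  have e1 : (p.moore.map (C.postcomp a.src q.snd)).map (C.postcomp a.src r.snd) =
      p.moore.map (C.postcomp a.src (q.snd ≫ r.snd)) :=
    MoorePath.ext (fun t => Category.assoc _ _ _) rfl
  have e2 : (q.moore.map (C.precomp p.fst c.tgt)).map (C.postcomp a.src r.snd) =
      (q.moore.map (C.postcomp b.src r.snd)).map (C.precomp p.fst d.tgt) :=
    MoorePath.ext (fun t => Category.assoc _ _ _) rfl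
  have e3 : r.moore.map (C.precomp (p.fst ≫ q.fst) d.tgt) =
      (r.moore.map (C.precomp q.fst d.tgt)).map (C.precomp p.fst d.tgt) :=
    MoorePath.ext (fun t => Category.assoc _ _ _) rfl
  have h1 : (comp p q).moore.map (C.postcomp a.src r.snd) = _ :=
    (MoorePath.map_concat _ _ _ (comp_aux p q)).trans (MoorePath.concat_congr _ e1 e2)
  have h2 : (comp q r).moore.map (C.precomp p.fst d.tgt) = _ :=
    MoorePath.map_concat _ _ _ (comp_aux q r)
  exact (MoorePath.concat_congr (comp_aux (comp p q) r) h1 e3).trans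
    ((MoorePath.concat_assoc _ _ _ _ _).trans
      (MoorePath.concat_congr (comp_aux p (comp q r)) rfl h2).symm)

theorem continuous_comp {Z : Type v} [TopologicalSpace Z]
    [UCompactlyGeneratedSpace.{u} (Z × ℝ≥0)] [UCompactlyGeneratedSpace.{u} Z]
    {F : Z → PathHom a b} {G : Z → PathHom b c} (hF : Continuous F) (hG : Continuous G) :
    Continuous fun z => comp (F z) (G z) := by
  obtain ⟨f1, f2, f3⟩ := continuous_iff.1 hF
  obtain ⟨g1, g2, g3⟩ := continuous_iff.1 hG
  refine continuous_iff.2 ⟨C.continuous_comp_of_continuous f1 g1,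
    C.continuous_comp_of_continuous f2 g2, ?_⟩
  refine MoorePath.continuous_concat (MoorePath.continuous_iff.2 ⟨?_, ?_⟩)
    (MoorePath.continuous_iff.2 ⟨?_, ?_⟩) fun z => comp_aux (F z) (G z)
  · exact C.continuous_comp_of_continuous (MoorePath.continuous_iff.1 f3).1
      (g2.comp _root_.continuous_fst)
  · exact (MoorePath.continuous_iff.1 f3).2
  · exact C.continuous_comp_of_continuous (f1.comp _root_.continuous_fst)
      (MoorePath.continuous_iff.1 g3).1
  · exact (MoorePath.continuous_iff.1 g3).2

/-- The action of a morphism of topological categories on the morphisms of `P(C)`. -/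
def map (F : Hom C D) (p : PathHom a b) : PathHom (a.map F) (b.map F) :=
  mk (F.functor.map p.fst) (F.functor.map p.snd) (p.moore.map (F.mapSpace a.src b.tgt))
    ((congrArg F.functor.map p.moore_source).trans (F.functor.map_comp _ _))
    ((congrArg F.functor.map p.moore_target).trans (F.functor.map_comp _ _))

theorem map_id (F : Hom C D) (a : C.PathObj) : map F (id a) = id (a.map F) :=
  ext (F.functor.map_id _) (F.functor.map_id _) rfl

theorem map_comp (F : Hom C D) (p : PathHom a b) (q : PathHom b c) :
    map F (comp p q) = comp (map F p) (map F q) := by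
  refine ext (F.functor.map_comp _ _) (F.functor.map_comp _ _) ?_
  refine (MoorePath.map_concat _ _ _ (comp_aux p q)).trans ?_
  refine MoorePath.concat_congr _ ?_ ?_
  · exact MoorePath.ext (fun t => F.functor.map_comp _ _) rfl
  · exact MoorePath.ext (fun t => F.functor.map_comp _ _) rfl

theorem continuous_map (F : Hom C D) : Continuous (map F : PathHom a b → _) := by
  exact continuous_iff.2 ⟨(F.continuous_map _ _).comp continuous_fst,
    (F.continuous_map _ _).comp continuous_snd, (MoorePath.continuous_map _).comp continuous_moore⟩

end PathHom

instance : Category C.PathObj where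
  Hom a b := KSpace (PathHom a b)
  id a := toK (PathHom.id a)
  comp p q := toK (PathHom.comp (unK p) (unK q))
  id_comp p := congrArg toK (PathHom.id_comp (unK p))
  comp_id p := congrArg toK (PathHom.comp_id (unK p))
  assoc p q r := congrArg toK (PathHom.assoc (unK p) (unK q) (unK r))

instance (a b : C.PathObj) : TopologicalSpace (a ⟶ b) :=
  inferInstanceAs (TopologicalSpace (KSpace (PathHom a b)))

instance (a b : C.PathObj) : CompactlyGeneratedSpace (a ⟶ b) :=
  inferInstanceAs (CompactlyGeneratedSpace (KSpace (PathHom a b)))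

/-- The topological category `P(C)`. -/
def pathCat (C : CatTop.{u}) : CatTop.{u} where
  Obj := C.PathObj
  continuous_comp a b c := by
    refine continuous_of_test fun S g => ?_
    exact continuous_toK_comp (PathHom.continuous_comp
      (continuous_unK.comp (continuous_fst.comp g.continuous))
      (continuous_unK.comp (continuous_snd.comp g.continuous)))

/-- The functor `P : CatTop ⥤ CatTop`. -/
def path : CatTop.{u} ⥤ CatTop.{u} where
  obj C := C.pathCat
  map {C D} F :=
    { functor :=
        { obj := fun a => PathObj.map F a
          map := fun {a b : C.PathObj} (p : KSpace (PathHom a b)) => toK (PathHom.map F (unK p))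
          map_id := fun (a : C.PathObj) => congrArg toK (PathHom.map_id F a)
          map_comp := fun {a b c : C.PathObj} (p : KSpace (PathHom a b)) (q : KSpace (PathHom b c)) =>
            congrArg toK (PathHom.map_comp F (unK p) (unK q)) }
      continuous_map := fun (a b : C.PathObj) =>
        continuous_toK_comp (Z := KSpace (PathHom a b))
          ((PathHom.continuous_map F).comp continuous_unK) }

/-- The identity of `x`, as an object of `P(C)`. -/
def constObj (x : C.Obj) : C.PathObj := ⟨x, x, 𝟙 x, C.isWeakEquiv_id x⟩

/-- The morphism `(f, f, const)` of `P(C)`, where the constant Moore path has length `0`. -/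
def constHom {x y : C.Obj} (f : x ⟶ y) : PathHom (constObj x) (constObj y) :=
  PathHom.mk f f (MoorePath.const f) (Category.id_comp f).symm (Category.comp_id f).symm

theorem constObj_eq {x : C.Obj} (m : x ⟶ x) (hm : C.IsWeakEquiv m) (h : 𝟙 x = m) :
    constObj x = ⟨x, x, m, hm⟩ := by
  subst h
  rfl

theorem constHom_eq {x y : C.Obj} {m : x ⟶ x} {n : y ⟶ y} (hm : C.IsWeakEquiv m)
    (hn : C.IsWeakEquiv n) (h : 𝟙 x = m) (h' : 𝟙 y = n) (f : x ⟶ y)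
    (p : PathHom (⟨x, x, m, hm⟩ : C.PathObj) ⟨y, y, n, hn⟩) (h1 : p.fst = f) (h2 : p.snd = f)
    (h3 : p.moore = MoorePath.const f) :
    (toK (constHom f) : constObj x ⟶ constObj y) =
      eqToHom (constObj_eq m hm h) ≫ (toK p : (⟨x, x, m, hm⟩ : C.PathObj) ⟶ ⟨y, y, n, hn⟩) ≫
        eqToHom (constObj_eq n hn h').symm := by
  subst h h'
  have : p = constHom f := PathHom.ext h1 h2 h3
  subst this
  let q : constObj x ⟶ constObj y := toK (constHom f)
  exact ((Category.id_comp _).trans (Category.comp_id q)).symm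

/-- The morphism `i : C ⟶ P(C)`, `x ↦ (𝟙 : x ⟶ x)`, as a natural transformation. -/
def inclusion : 𝟭 CatTop.{u} ⟶ path where
  app C :=
    { functor :=
        { obj := fun x => constObj x
          map := fun f => toK (constHom f)
          map_id := fun x => rfl
          map_comp := fun {x y z} f g => by
            refine congrArg toK (PathHom.ext rfl rfl ?_)
            refine ((MoorePath.concat_congr (PathHom.comp_aux (constHom f) (constHom g))
              rfl rfl).trans (MoorePath.const_concat _ (f ≫ g) rfl)).symm }
      continuous_map := fun x y => continuous_toK_comp (PathHom.continuous_iff.2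
        ⟨continuous_id, continuous_id, MoorePath.continuous_const⟩) }
  naturality C D F := by
    refine hom_ext (CategoryTheory.Functor.ext
      (fun x => constObj_eq _ _ (F.functor.map_id x).symm) fun x y f => ?_)
    exact constHom_eq _ _ (F.functor.map_id x).symm (F.functor.map_id y).symm
      (F.functor.map f) _ rfl rfl rfl

/-- The morphism `ev_s : P(C) ⟶ C`, `(x ⟶ y) ↦ x`. -/
def evalSrc (C : CatTop.{u}) : C.pathCat ⟶ C where
  functor :=
    { obj := fun a => PathObj.src a
      map := fun {a b : C.PathObj} (p : KSpace (PathHom a b)) => (unK p).fst }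
  continuous_map (a b : C.PathObj) :=
    have h : Continuous fun p : KSpace (PathHom a b) => (unK p).fst :=
      PathHom.continuous_fst.comp continuous_unK
    h

/-- The morphism `ev_t : P(C) ⟶ C`, `(x ⟶ y) ↦ y`. -/
def evalTgt (C : CatTop.{u}) : C.pathCat ⟶ C where
  functor :=
    { obj := fun a => PathObj.tgt a
      map := fun {a b : C.PathObj} (p : KSpace (PathHom a b)) => (unK p).snd }
  continuous_map (a b : C.PathObj) :=
    have h : Continuous fun p : KSpace (PathHom a b) => (unK p).snd :=
      PathHom.continuous_snd.comp continuous_unK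
    h

/-- The morphism `(ev_s, ev_t) : P(C) ⟶ C × C`, as a natural transformation. -/
def evaluation : path ⟶ square.{u} where
  app C := prodLift C.evalSrc C.evalTgt
  naturality _ _ _ := rfl

/-- The (pre-)path object `C ⟶ P(C) ⇉ C`. -/
def prepathObject (C : CatTop.{u}) : PrepathObject C where
  P := path.obj C
  p₀ := C.evalSrc
  p₁ := C.evalTgt
  ι := inclusion.app C
  ι_p₀ := rfl
  ι_p₁ := rfl

/-! ### The pullback squares defining the mapping spaces -/

/-- `Map(x, x') × Map(y, y')`, the product being formed in compactly generated spaces. -/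
abbrev endpointSpace (a b : C.PathObj) : CompactlyGenerated.{u, u} :=
  .of (KSpace ((a.src ⟶ b.src) × (a.tgt ⟶ b.tgt)))

/-- The Moore path space `𝓜(Map(x, y'))`. -/
abbrev mooreSpace (a b : C.PathObj) : CompactlyGenerated.{u, u} :=
  .of (KSpace (MoorePath (a.src ⟶ b.tgt)))

/-- `Map(x, y') × Map(x, y')`, the product being formed in compactly generated spaces. -/
abbrev cornerSpace (a b : C.PathObj) : CompactlyGenerated.{u, u} :=
  .of (KSpace ((a.src ⟶ b.tgt) × (a.src ⟶ b.tgt)))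

/-- The mapping space of `P(C)`. -/
abbrev pathMapSpace (a b : C.PathObj) : CompactlyGenerated.{u, u} := .of (a ⟶ b)

/-- The projection of the mapping space of `P(C)` to the Moore path space. -/
def toMoore (a b : C.PathObj) : pathMapSpace a b ⟶ mooreSpace a b :=
  CompactlyGenerated.ofHom ⟨fun p => toK (unK p).moore,
    continuous_toK_comp (PathHom.continuous_moore.comp continuous_unK)⟩

/-- The map `(ev_s, ev_t)` on mapping spaces. -/
def toEndpoints (a b : C.PathObj) : pathMapSpace a b ⟶ endpointSpace a b :=
  CompactlyGenerated.ofHom ⟨fun p => toK ((unK p).fst, (unK p).snd),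
    continuous_toK_comp ((PathHom.continuous_fst.prodMk
      PathHom.continuous_snd).comp continuous_unK)⟩

/-- The map `(δ₋, δ₊)` to the end points of Moore paths. -/
def mooreEnds (a b : C.PathObj) : mooreSpace a b ⟶ cornerSpace a b :=
  CompactlyGenerated.ofHom ⟨fun α => toK ((unK α).source, (unK α).target),
    continuous_toK_comp ((MoorePath.continuous_source.prodMk
      MoorePath.continuous_target).comp continuous_unK)⟩

/-- The map `(f, g) ↦ (g ∘ a, b ∘ f)`. -/
def whisker (a b : C.PathObj) : endpointSpace a b ⟶ cornerSpace a b :=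
  CompactlyGenerated.ofHom ⟨fun p => toK (a.hom ≫ (unK p).2, (unK p).1 ≫ b.hom),
    continuous_toK_comp ((((C.precomp a.hom b.tgt).continuous.comp continuous_snd).prodMk
      ((C.postcomp a.src b.hom).continuous.comp continuous_fst)).comp continuous_unK)⟩

end CatTop

end

/-! Everything rests on Moore paths having a concatenation that is strictly associative, with paths
of length zero as strict units. This makes lifts and deformations start and end exactly where they
should, with no reparametrization.

Fibration on mapping spaces: a homotopy of the components `(f, g)` lifts by running backwards along
`a ≫ g`, then along the given Moore path, then forwards along `f ≫ b`, the added pieces having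
length `s` at time `s` (`MoorePath.extend`, `PathHom.transport`). At time zero nothing is added, so
the lift starts at the prescribed morphism.

The inclusion on mapping spaces: between identity objects, erasing longer and longer initial
segments of the Moore path (`PathHom.slide`) contracts the mapping space of `P(C)` onto the constant
paths of length zero, that is, onto the mapping space of `C`.

The remaining conditions concern objects, and both follow from `isWeakEquiv_path`: a morphism of
`P(C)` is a weak equivalence once both components are. Homotopy inverses of the components are
assembled into a morphism backwards. The two composites have components homotopic to identities, so
by homotopy lifting they may be replaced by Moore loops, which are invertible up to homotopy by
reversal. Essential surjectivity of the inclusion and the lifting of weak equivalences are then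
explicit constructions.

Compactly generated topologies cause no trouble: the cubes, paths and cone points used as sources
are compactly generated, so continuity is checked in the ordinary topology. -/

noncomputable section

/-! ### Moore paths obtained by restriction -/

namespace MoorePath

variable {X : Type v} [TopologicalSpace X]

/-- The Moore path of length `s` following a map `c : ℝ≥0 → X` from `c 0` to `c s`. -/
def initial (c : C(ℝ≥0, X)) (s : ℝ≥0) : MoorePath X :=
  ⟨(c.comp ⟨fun t => min t s, by fun_prop⟩, s), fun t ht => by
    change c (min t s) = c (min s s)
    rw [min_eq_right ht, min_self]⟩

/-- The Moore path of length `s` following a map `c : ℝ≥0 → X` backwards from `c s` to `c 0`. -/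
def reversal (c : C(ℝ≥0, X)) (s : ℝ≥0) : MoorePath X :=
  -- Truncated subtraction keeps the path at `c 0` after time `s`.
  ⟨(c.comp ⟨fun t => s - t, by fun_prop⟩, s), fun t ht => by
    change c (s - t) = c (s - s)
    rw [tsub_eq_zero_of_le ht, tsub_self]⟩

/-- The Moore path obtained from `α` by removing an initial segment of length `s`. -/
def drop (α : MoorePath X) (s : ℝ≥0) : MoorePath X :=
  -- Truncated subtraction again: for `s` beyond the length of `α` this is the path of length zero
  -- at its target.
  ⟨(α.path.comp ⟨fun t => s + t, by fun_prop⟩, α.length - s), fun t ht => by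
    change α.path (s + t) = α.path (s + (α.length - s))
    rw [α.path_eq_target (tsub_le_iff_left.1 ht), α.path_eq_target le_add_tsub]⟩

theorem initial_source (c : C(ℝ≥0, X)) (s : ℝ≥0) : (initial c s).source = c 0 :=
  congrArg c (min_eq_left bot_le)

theorem initial_target (c : C(ℝ≥0, X)) (s : ℝ≥0) : (initial c s).target = c s :=
  congrArg c (min_self s)

theorem reversal_source (c : C(ℝ≥0, X)) (s : ℝ≥0) : (reversal c s).source = c s :=
  congrArg c (tsub_zero s)

theorem reversal_target (c : C(ℝ≥0, X)) (s : ℝ≥0) : (reversal c s).target = c 0 :=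
  congrArg c (tsub_self s)

theorem drop_source (α : MoorePath X) (s : ℝ≥0) : (α.drop s).source = α.path s :=
  congrArg α.path (add_zero s)

theorem drop_target (α : MoorePath X) (s : ℝ≥0) : (α.drop s).target = α.target :=
  α.path_eq_target le_add_tsub

theorem initial_zero (c : C(ℝ≥0, X)) : initial c 0 = const (c 0) :=
  ext (fun _ => congrArg c (min_eq_right bot_le)) rfl

theorem reversal_zero (c : C(ℝ≥0, X)) : reversal c 0 = const (c 0) :=
  ext (fun _ => congrArg c (zero_tsub _)) rfl

theorem initial_length (α : MoorePath X) : initial α.path α.length = α := by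
  refine ext (fun t => ?_) rfl
  change α.path (min t α.length) = α.path t
  rcases le_total t α.length with h | h
  · rw [min_eq_left h]
  · rw [min_eq_right h, α.path_eq_target h, target]

theorem drop_zero (α : MoorePath X) : α.drop 0 = α :=
  ext (fun t => congrArg α.path (zero_add t)) (tsub_zero _)

theorem drop_length (α : MoorePath X) : α.drop α.length = const α.target :=
  ext (fun _ => α.path_eq_target le_self_add) (tsub_self _)

theorem const_drop (x : X) (s : ℝ≥0) : (const x).drop s = const x :=
  ext (fun _ => rfl) (zero_tsub _)

variable {Z : Type*} [TopologicalSpace Z]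

theorem continuous_initial {c : Z → C(ℝ≥0, X)} {s : Z → ℝ≥0}
    (hc : Continuous fun p : Z × ℝ≥0 => c p.1 p.2) (hs : Continuous s) :
    Continuous fun z => initial (c z) (s z) :=
  continuous_iff.2 ⟨hc.comp (continuous_fst.prodMk
    (continuous_snd.min (hs.comp continuous_fst))), hs⟩

theorem continuous_reversal {c : Z → C(ℝ≥0, X)} {s : Z → ℝ≥0}
    (hc : Continuous fun p : Z × ℝ≥0 => c p.1 p.2) (hs : Continuous s) :
    Continuous fun z => reversal (c z) (s z) :=
  continuous_iff.2 ⟨hc.comp (continuous_fst.prodMk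
    ((hs.comp continuous_fst).sub continuous_snd)), hs⟩

theorem continuous_drop {α : Z → MoorePath X} {s : Z → ℝ≥0}
    (hα : Continuous α) (hs : Continuous s) : Continuous fun z => (α z).drop (s z) :=
  continuous_iff.2 ⟨(continuous_iff.1 hα).1.comp (continuous_fst.prodMk
    ((hs.comp continuous_fst).add continuous_snd)), (continuous_iff.1 hα).2.sub hs⟩

/-- The inclusion of the unit interval in the half-line. -/
def unitLength : C(I, ℝ≥0) := ⟨fun s => ⟨s, s.2.1⟩, by fun_prop⟩

/-- The retraction of the half-line onto the unit interval. -/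
def clamp : C(ℝ≥0, I) := ⟨fun t => Set.projIcc 0 1 zero_le_one t, by fun_prop⟩

theorem clamp_unitLength (s : I) : clamp (unitLength s) = s := Set.projIcc_val zero_le_one s

theorem clamp_zero : clamp 0 = 0 := Set.projIcc_left (zero_le_one' ℝ)

theorem unitLength_zero : unitLength 0 = 0 := rfl

theorem unitLength_one : unitLength 1 = 1 := rfl

theorem exists_of_joined {x y : X} (h : Joined x y) :
    ∃ α : MoorePath X, α.source = x ∧ α.target = y := by
  obtain ⟨p⟩ := h
  refine ⟨initial (p.toContinuousMap.comp clamp) 1, ?_, ?_⟩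
  · rw [initial_source]
    change p (clamp 0) = x
    rw [clamp_zero, p.source]
  · rw [initial_target, ← unitLength_one]
    change p (clamp (unitLength 1)) = y
    rw [clamp_unitLength, p.target]

/-- The Moore path from `h s` to `k s` which follows `h` backwards, then `α`, then `k`. -/
def extend (h k : C(I, X)) (α : MoorePath X) (s : I) (h0 : h 0 = α.source) (k0 : α.target = k 0) :
    MoorePath X :=
  -- `clamp` only serves to extend `h` and `k` to the half-line; they are read at times at most `s ≤
  -- 1`.
  concat (concat (reversal (h.comp clamp) (unitLength s)) α
      ((reversal_target _ _).trans ((congrArg h clamp_zero).trans h0)))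
    (initial (k.comp clamp) (unitLength s))
    ((concat_target _ _ _).trans (k0.trans
      ((congrArg k clamp_zero).symm.trans (initial_source (k.comp clamp) _).symm)))

section

variable (h k : C(I, X)) (α : MoorePath X) (s : I) (h0 : h 0 = α.source) (k0 : α.target = k 0)

theorem extend_source : (extend h k α s h0 k0).source = h s := by
  rw [extend, concat_source, concat_source, reversal_source, ContinuousMap.comp_apply,
    clamp_unitLength]

theorem extend_target : (extend h k α s h0 k0).target = k s := by
  rw [extend, concat_target, initial_target, ContinuousMap.comp_apply, clamp_unitLength]

/-- Both added segments have length zero, hence are strict units. This equality, rather than a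
homotopy, is what makes `extend` solve a lifting problem. -/
theorem extend_zero : extend h k α 0 h0 k0 = α := by
  have e1 : reversal (h.comp clamp) (unitLength 0) = const (h (clamp 0)) := reversal_zero _
  have e2 : initial (k.comp clamp) (unitLength 0) = const (k (clamp 0)) := initial_zero _
  unfold extend
  refine (concat_congr _ (?_ : _ = α) e2).trans (concat_const _ _ _)
  exact (concat_congr _ e1 rfl).trans (const_concat _ _ _)

end

theorem continuous_extend {h k : Z → C(I, X)} {α : Z → MoorePath X} {s : Z → I}
    (hh : Continuous fun p : Z × I => h p.1 p.2) (hk : Continuous fun p : Z × I => k p.1 p.2)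
    (hα : Continuous α) (hs : Continuous s) (h0 : ∀ z, h z 0 = (α z).source)
    (k0 : ∀ z, (α z).target = k z 0) :
    Continuous fun z => extend (h z) (k z) (α z) (s z) (h0 z) (k0 z) := by
  have hu := unitLength.continuous.comp hs
  have hc : Continuous fun p : Z × ℝ≥0 => (p.1, clamp p.2) :=
    continuous_fst.prodMk (clamp.continuous.comp continuous_snd)
  exact continuous_concat
    (continuous_concat (continuous_reversal (c := fun z => (h z).comp clamp) (hh.comp hc) hu) hα _)
    (continuous_initial (c := fun z => (k z).comp clamp) (hk.comp hc) hu) _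

end MoorePath

/-! ### Deformation retracts -/

/-- The interval is compactly generated, so passing to the compactly generated topology does not
change paths. -/
theorem joined_toK {Y : Type u} [TopologicalSpace Y] {x y : KSpace Y}
    (h : Joined (unK x) (unK y)) : Joined x y := by
  obtain ⟨p⟩ := h
  exact ⟨⟨⟨fun t => toK (p t), continuous_toK_comp p.continuous⟩, congrArg toK p.source,
    congrArg toK p.target⟩⟩

/-- The inclusion of a strong deformation retract is a weak homotopy equivalence. -/
theorem isWeakHomotopyEquiv_of_deformationRetract {X : Type v} [TopologicalSpace X]
    {Y : Type u} [TopologicalSpace Y] (i : C(X, KSpace Y)) (r : C(KSpace Y, X))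
    (H : C(Y × I, Y)) (hr : ∀ x, r (i x) = x) (h0 : ∀ y, H (y, 0) = y)
    (h1 : ∀ y : KSpace Y, H (unK y, 1) = unK (i (r y)))
    (hi : ∀ x t, H (unK (i x), t) = unK (i x)) : IsWeakHomotopyEquiv i := by
  have hri : r.comp i = ContinuousMap.id X := ContinuousMap.ext hr
  refine ⟨⟨?_, ?_⟩, fun n x => ⟨?_, ?_⟩⟩
  · rintro ⟨x⟩ ⟨y⟩ h
    have h' : Joined (r (i x)) (r (i y)) := (Quotient.exact h : Joined (i x) (i y)).map r.continuous
    rw [hr, hr] at h'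
    exact Quotient.sound h'
  · rintro ⟨y⟩
    refine ⟨Quotient.mk _ (r y), Quotient.sound (?_ : Joined (i (r y)) y)⟩
    refine (joined_toK ⟨⟨⟨fun t => H (unK y, t), by fun_prop⟩, h0 _, h1 _⟩⟩).symm
  · rintro ⟨p⟩ ⟨q⟩ h
    -- Composing the homotopy itself with `r` avoids transporting homotopy groups along `r (i x) =
    -- x`.
    have h' : ((i.comp p.1).HomotopicRel (i.comp q.1) (Cube.boundary _)) := Quotient.exact h
    have h'' := h'.comp_continuousMap r
    rw [← ContinuousMap.comp_assoc, ← ContinuousMap.comp_assoc, hri] at h''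
    exact Quotient.sound h''
  · rintro ⟨p⟩
    refine ⟨Quotient.mk _ ⟨r.comp p.1, fun y hy => (congrArg r (p.2 y hy)).trans (hr x)⟩,
      Quotient.sound (?_ : (i.comp (r.comp p.1)).HomotopicRel p.1 (Cube.boundary _))⟩
    -- `H` is continuous only for the ordinary topology of `Y`; restricted along a cube it becomes
    -- continuous into `KSpace Y`.
    have hc : Continuous fun z : I × (Fin (n + 1) → I) => toK (H (unK (p.1 z.2), z.1)) := by
      refine continuous_toK_comp (H.continuous.comp ((continuous_unK.comp ?_).prodMk
        continuous_fst))
      exact p.1.continuous.comp continuous_snd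
    refine ContinuousMap.HomotopicRel.symm ⟨⟨⟨⟨_, hc⟩, fun y => h0 _, fun y => h1 _⟩, ?_⟩⟩
    intro t y hy
    change toK (H (unK (p.1 y), t)) = p.1 y
    rw [p.2 y hy]
    -- The deformation is strong, so the base point `i x` stays put and the homotopy is relative to
    -- the boundary of the cube.
    exact hi x t

/-! ### The homotopy category -/

namespace CatTop

theorem toHo_map_eq_iff {C : CatTop.{u}} {x y : C.Obj} (f g : x ⟶ y) :
    C.toHo.map f = C.toHo.map g ↔ Joined f g :=
  Quotient.functor_map_eq_iff _ f g

theorem IsWeakEquiv.comp {C : CatTop.{u}} {x y z : C.Obj} {f : x ⟶ y} {g : y ⟶ z}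
    (hf : C.IsWeakEquiv f) (hg : C.IsWeakEquiv g) : C.IsWeakEquiv (f ≫ g) := by
  unfold IsWeakEquiv at *
  rw [Functor.map_comp]
  infer_instance

theorem isWeakEquiv_eqToHom {C : CatTop.{u}} {x y : C.Obj} (h : x = y) :
    C.IsWeakEquiv (eqToHom h) := by
  subst h
  exact C.isWeakEquiv_id x

/-- A homotopy inverse of a weak equivalence. -/
theorem IsWeakEquiv.exists_inverse {C : CatTop.{u}} {x y : C.Obj} {f : x ⟶ y}
    (hf : C.IsWeakEquiv f) : ∃ g : y ⟶ x, C.IsWeakEquiv g ∧ Joined (f ≫ g) (𝟙 x) ∧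
      Joined (g ≫ f) (𝟙 y) := by
  have : IsIso (C.toHo.map f) := hf
  obtain ⟨g, hg⟩ := C.toHo.map_surjective (inv (C.toHo.map f))
  refine ⟨g, ?_, ?_, ?_⟩
  · unfold IsWeakEquiv
    rw [hg]
    infer_instance
  · rw [← toHo_map_eq_iff, Functor.map_comp, hg]
    simp
  · rw [← toHo_map_eq_iff, Functor.map_comp, hg]
    simp

/-- Morphisms of `π₀` are path components of mapping spaces: injectivity on components is
faithfulness, surjectivity is fullness, and weak equivalences are the isomorphisms needed for
essential surjectivity. -/
theorem Hom.ho_isEquivalence {C D : CatTop.{u}} (F : Hom C D)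
    (hF : ∀ x y, Function.Bijective (ZerothHomotopy.push (F.mapSpace x y)))
    (hs : ∀ d : D.Obj, ∃ (c : C.Obj) (e : F.functor.obj c ⟶ d), D.IsWeakEquiv e) :
    F.ho.IsEquivalence where
  faithful := ⟨by
    rintro ⟨x⟩ ⟨y⟩ f g h
    obtain ⟨f, rfl⟩ := C.toHo.map_surjective f
    obtain ⟨g, rfl⟩ := C.toHo.map_surjective g
    have h' : Joined (F.functor.map f) (F.functor.map g) := (toHo_map_eq_iff _ _).1 h
    rw [toHo_map_eq_iff]
    exact Quotient.exact ((hF x y).1 (Quotient.sound h' :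
      ZerothHomotopy.push (F.mapSpace x y) (Quotient.mk _ f) =
        ZerothHomotopy.push (F.mapSpace x y) (Quotient.mk _ g)))⟩
  full := ⟨by
    rintro ⟨x⟩ ⟨y⟩ g
    obtain ⟨g, rfl⟩ := D.toHo.map_surjective (X := F.functor.obj x) (Y := F.functor.obj y) g
    obtain ⟨⟨f⟩, hf⟩ := (hF x y).2 (Quotient.mk _ g)
    exact ⟨C.toHo.map f, (toHo_map_eq_iff _ _).2 (Quotient.exact hf)⟩⟩
  essSurj := ⟨by
    rintro ⟨d⟩
    obtain ⟨c, e, he⟩ := hs d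
    exact ⟨C.toHo.obj c, ⟨@asIso _ _ _ _ (D.toHo.map e) he⟩⟩⟩

variable {C D : CatTop.{u}}

/-- Through this, any two members of a continuous family indexed by `ℝ≥0` are joined: the end points
of a Moore path, or the stages of a contraction. -/
theorem joined_nnreal (s t : ℝ≥0) : Joined s t := by
  have key : ∀ s : ℝ≥0, Joined 0 s := fun s =>
    ⟨⟨⟨fun x => MoorePath.unitLength x * s, by fun_prop⟩, by
      change MoorePath.unitLength 0 * s = 0
      rw [MoorePath.unitLength_zero, zero_mul], by
      change MoorePath.unitLength 1 * s = s
      rw [MoorePath.unitLength_one, one_mul]⟩⟩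
  exact (key s).symm.trans (key t)

/-! ### Lifting homotopies to the mapping spaces of the path category -/

namespace PathHom

variable {a b c : C.PathObj}

/-- The morphism of `P(C)` obtained from `p` by following homotopies of its components. -/
def transport (p : PathHom a b) (f : C(I, a.src ⟶ b.src)) (g : C(I, a.tgt ⟶ b.tgt)) (s : I)
    (hf : f 0 = p.fst) (hg : g 0 = p.snd) : PathHom a b :=
  mk (f s) (g s)
    (MoorePath.extend ((C.precomp a.hom b.tgt).comp g) ((C.postcomp a.src b.hom).comp f) p.moore s
      ((congrArg (fun g => a.hom ≫ g) hg).trans p.moore_source.symm)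
      (p.moore_target.trans (congrArg (fun f => f ≫ b.hom) hf.symm)))
    (MoorePath.extend_source (h := (C.precomp a.hom b.tgt).comp g) ..)
    (MoorePath.extend_target (k := (C.postcomp a.src b.hom).comp f) ..)

theorem transport_zero (p : PathHom a b) (f : C(I, a.src ⟶ b.src)) (g : C(I, a.tgt ⟶ b.tgt))
    (hf : f 0 = p.fst) (hg : g 0 = p.snd) : transport p f g 0 hf hg = p :=
  ext hf hg (MoorePath.extend_zero (h := (C.precomp a.hom b.tgt).comp g)
    (k := (C.postcomp a.src b.hom).comp f) (α := p.moore)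
    ((congrArg (fun g => a.hom ≫ g) hg).trans p.moore_source.symm)
    (p.moore_target.trans (congrArg (fun f => f ≫ b.hom) hf.symm)))

theorem continuous_transport {Z : Type*} [TopologicalSpace Z] {p : Z → PathHom a b}
    {f : Z → C(I, a.src ⟶ b.src)} {g : Z → C(I, a.tgt ⟶ b.tgt)} {s : Z → I}
    (hp : Continuous p) (hf : Continuous fun z : Z × I => f z.1 z.2)
    (hg : Continuous fun z : Z × I => g z.1 z.2) (hs : Continuous s)
    (hf0 : ∀ z, f z 0 = (p z).fst) (hg0 : ∀ z, g z 0 = (p z).snd) :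
    Continuous fun z => transport (p z) (f z) (g z) (s z) (hf0 z) (hg0 z) := by
  have hs' : Continuous fun z => (z, s z) := continuous_id.prodMk hs
  refine continuous_iff.2 ⟨hf.comp hs', hg.comp hs', ?_⟩
  exact MoorePath.continuous_extend
    (h := fun z => (C.precomp a.hom b.tgt).comp (g z))
    (k := fun z => (C.postcomp a.src b.hom).comp (f z))
    ((C.precomp a.hom b.tgt).continuous.comp hg) ((C.postcomp a.src b.hom).continuous.comp hf)
    (continuous_moore.comp hp) hs
    (fun z => (congrArg (fun g => a.hom ≫ g) (hg0 z)).trans (p z).moore_source.symm)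
    (fun z => (p z).moore_target.trans (congrArg (fun f => f ≫ b.hom) (hf0 z).symm))

/-- Path lifting: `transport` at time one is the required morphism, and the earlier times form the
path to it from `p`. -/
theorem exists_joined (p : PathHom a b) {f : a.src ⟶ b.src} {g : a.tgt ⟶ b.tgt}
    (hf : Joined p.fst f) (hg : Joined p.snd g) :
    ∃ q : PathHom a b, q.fst = f ∧ q.snd = g ∧ Joined p q := by
  obtain ⟨F⟩ := hf
  obtain ⟨G⟩ := hg
  refine ⟨transport p F.toContinuousMap G.toContinuousMap 1 F.source G.source, F.target, G.target,
    ⟨⟨⟨fun s => transport p F.toContinuousMap G.toContinuousMap s F.source G.source, ?_⟩,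
      transport_zero _ _ _ F.source G.source, rfl⟩⟩⟩
  exact continuous_transport (p := fun _ => p) (f := fun _ => F.toContinuousMap)
    (g := fun _ => G.toContinuousMap) continuous_const (F.continuous.comp _root_.continuous_snd)
    (G.continuous.comp _root_.continuous_snd) continuous_id (fun _ => F.source) fun _ => G.source

/-! ### Weak equivalences of the path category -/

/-- The endomorphism of `a` whose components are identities, given by a Moore loop at `a`. -/
def ofLoop (α : MoorePath (a.src ⟶ a.tgt)) (h1 : α.source = a.hom) (h2 : α.target = a.hom) :
    PathHom a a :=
  mk (𝟙 _) (𝟙 _) α (h1.trans (Category.comp_id _).symm) (h2.trans (Category.id_comp _).symm)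

theorem ofLoop_eq_id (α : MoorePath (a.src ⟶ a.tgt)) (h1 : α.source = a.hom)
    (h2 : α.target = a.hom) (h : α = MoorePath.const a.hom) : ofLoop α h1 h2 = id a :=
  ext rfl rfl h

theorem comp_ofLoop (α β : MoorePath (a.src ⟶ a.tgt)) (h1 : α.source = a.hom)
    (h2 : α.target = a.hom) (k1 : β.source = a.hom) (k2 : β.target = a.hom) :
    comp (ofLoop α h1 h2) (ofLoop β k1 k2) = ofLoop (α.concat β (h2.trans k1.symm))
      ((MoorePath.concat_source _ _ _).trans h1) ((MoorePath.concat_target _ _ _).trans k2) := by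
  refine ext (Category.id_comp (𝟙 _)) (Category.id_comp (𝟙 _)) ?_
  refine MoorePath.concat_congr (comp_aux (ofLoop α h1 h2) (ofLoop β k1 k2)) ?_ ?_
  · exact MoorePath.ext (fun t => Category.comp_id _) rfl
  · exact MoorePath.ext (fun t => Category.id_comp _) rfl

theorem continuous_ofLoop {Z : Type*} [TopologicalSpace Z] {α : Z → MoorePath (a.src ⟶ a.tgt)}
    (hα : Continuous α) (h1 : ∀ z, (α z).source = a.hom) (h2 : ∀ z, (α z).target = a.hom) :
    Continuous fun z => ofLoop (α z) (h1 z) (h2 z) :=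
  continuous_iff.2 ⟨continuous_const, continuous_const, hα⟩

/-- A loop followed by its reversal is homotopic to the constant loop. -/
theorem joined_concat_reversal (α : MoorePath (a.src ⟶ a.tgt)) (h1 : α.source = a.hom)
    (h2 : α.target = a.hom) :
    Joined (comp (ofLoop α h1 h2) (ofLoop (MoorePath.reversal α.path α.length)
      ((MoorePath.reversal_source _ _).trans h2) ((MoorePath.reversal_target _ _).trans h1)))
      (id a) := by
  have key (s : ℝ≥0) : (MoorePath.initial α.path s).target =
      (MoorePath.reversal α.path s).source :=
    (MoorePath.initial_target _ _).trans (MoorePath.reversal_source _ _).symm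
  -- Follow `α` up to time `s` and come back. Each stage is a loop at `a.hom` although `α` is
  -- elsewhere at time `s`; stage zero is the identity, and stage `α.length` is the whole composite.
  let γ (s : ℝ≥0) : PathHom a a :=
    ofLoop ((MoorePath.initial α.path s).concat (MoorePath.reversal α.path s) (key s))
      ((MoorePath.concat_source _ _ _).trans ((MoorePath.initial_source _ _).trans h1))
      ((MoorePath.concat_target _ _ _).trans ((MoorePath.reversal_target _ _).trans h1))
  have hγ : Continuous γ := by
    have hc : Continuous fun p : ℝ≥0 × ℝ≥0 => α.path p.2 :=
      α.path.continuous.comp _root_.continuous_snd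
    exact continuous_ofLoop (MoorePath.continuous_concat
      (MoorePath.continuous_initial (c := fun _ => α.path) hc continuous_id)
      (MoorePath.continuous_reversal (c := fun _ => α.path) hc continuous_id) key) _ _
  have e0 : γ 0 = id a := by
    refine ofLoop_eq_id _ _ _ ?_
    refine (MoorePath.concat_congr _ (MoorePath.initial_zero _) (MoorePath.reversal_zero _)).trans
      ((MoorePath.const_concat _ _ rfl).trans ?_)
    exact congrArg MoorePath.const h1
  have e1 : γ α.length = comp (ofLoop α h1 h2) (ofLoop (MoorePath.reversal α.path α.length)
      ((MoorePath.reversal_source _ _).trans h2) ((MoorePath.reversal_target _ _).trans h1)) := by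
    rw [comp_ofLoop]
    exact ext rfl rfl (MoorePath.concat_congr (key _) (MoorePath.initial_length _) rfl)
  rw [← e0, ← e1]
  exact (joined_nnreal α.length 0).map hγ

end PathHom

/-- If `g` is a right inverse of `f` and `k` one of `g`, then `k = f`. So only one of the two
null-homotopies of a loop and its reversal has to be constructed. -/
theorem isIso_of_forall_exists_rightInverse {E : Type*} [Category E] {X : E}
    {P : (X ⟶ X) → Prop} (h : ∀ f, P f → ∃ g, P g ∧ f ≫ g = 𝟙 X) {f : X ⟶ X} (hf : P f) :
    IsIso f := by
  obtain ⟨g, hg, hfg⟩ := h f hf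
  obtain ⟨k, -, hgk⟩ := h g hg
  have : k = f := by
    rw [← Category.id_comp k, ← hfg, Category.assoc, hgk, Category.comp_id]
  exact ⟨g, hfg, this ▸ hgk⟩

/-- A morphism of `P(C)` regarded in the homotopy category. -/
def pathHo {a b : C.PathObj} (p : PathHom a b) : C.pathCat.toHo.obj a ⟶ C.pathCat.toHo.obj b :=
  C.pathCat.toHo.map (X := a) (Y := b) (toK p : a ⟶ b)

theorem pathHo_comp {a b c : C.PathObj} (p : PathHom a b) (q : PathHom b c) :
    pathHo (p.comp q) = pathHo p ≫ pathHo q :=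
  C.pathCat.toHo.map_comp (X := a) (Y := b) (Z := c) (toK p : a ⟶ b) (toK q : b ⟶ c)

theorem pathHo_id (a : C.PathObj) : pathHo (PathHom.id a) = 𝟙 _ :=
  C.pathCat.toHo.map_id a

theorem pathHo_eq_of_joined {a b : C.PathObj} {p q : PathHom a b} (h : Joined p q) :
    pathHo p = pathHo q :=
  (toHo_map_eq_iff (C := C.pathCat) (x := a) (y := b) (toK p : a ⟶ b) (toK q : a ⟶ b)).2
    (joined_toK (Y := PathHom a b) (x := toK p) (y := toK q) h)

/-- Path lifting deforms `p` to a morphism with identity components, which is just a Moore loop at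
`a.hom`; the reversed loop is a right inverse and belongs to the same class. -/
theorem isIso_pathHo_of_joined_id {a : C.PathObj} (p : PathHom a a) (hf : Joined p.fst (𝟙 _))
    (hg : Joined p.snd (𝟙 _)) : IsIso (pathHo p) := by
  refine isIso_of_forall_exists_rightInverse
    (P := fun f => ∃ p : PathHom a a, Joined p.fst (𝟙 _) ∧ Joined p.snd (𝟙 _) ∧ pathHo p = f)
    ?_ ⟨p, hf, hg, rfl⟩
  rintro _ ⟨p, hf, hg, rfl⟩
  obtain ⟨q, hqf, hqg, hpq⟩ := p.exists_joined hf hg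
  have h1 : q.moore.source = a.hom := by rw [q.moore_source, hqg, Category.comp_id]
  have h2 : q.moore.target = a.hom := by rw [q.moore_target, hqf, Category.id_comp]
  have hq : q = PathHom.ofLoop q.moore h1 h2 := PathHom.ext hqf hqg rfl
  refine ⟨_, ⟨PathHom.ofLoop (MoorePath.reversal q.moore.path q.moore.length)
    ((MoorePath.reversal_source _ _).trans h2) ((MoorePath.reversal_target _ _).trans h1),
    Joined.refl _, Joined.refl _, rfl⟩, ?_⟩
  rw [(pathHo_eq_of_joined hpq).trans (congrArg pathHo hq), ← pathHo_comp]
  refine Eq.trans ?_ (pathHo_id a)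
  exact pathHo_eq_of_joined (PathHom.joined_concat_reversal _ h1 h2)

/-- A morphism of `P(C)` whose components are weak equivalences is a weak equivalence. -/
theorem isWeakEquiv_path {a b : C.PathObj} (p : PathHom a b) (hf : C.IsWeakEquiv p.fst)
    (hg : C.IsWeakEquiv p.snd) :
    C.pathCat.IsWeakEquiv (x := a) (y := b) (toK p : a ⟶ b) := by
  obtain ⟨f, hf', hf1, hf2⟩ := hf.exists_inverse
  obtain ⟨g, hg', hg1, hg2⟩ := hg.exists_inverse
  -- In `π₀ C` the Moore path of `p` gives a commutative square; inverting its two sides `p.fst` and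
  -- `p.snd` gives another, whose filler is the Moore path of the inverse candidate `q`.
  have hj : Joined (b.hom ≫ g) (f ≫ a.hom) := by
    rw [← toHo_map_eq_iff]
    have e1 := (toHo_map_eq_iff _ _).2 hf2
    have e2 := (toHo_map_eq_iff _ _).2 hg1
    have e3 : C.toHo.map (a.hom ≫ p.snd) = C.toHo.map (p.fst ≫ b.hom) := by
      rw [toHo_map_eq_iff, ← p.moore_source, ← p.moore_target]
      exact ((joined_nnreal 0 p.moore.length).map p.moore.path.continuous :)
    simp only [Functor.map_comp] at e1 e2 e3 ⊢
    calc C.toHo.map b.hom ≫ C.toHo.map g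
        = (C.toHo.map f ≫ C.toHo.map p.fst) ≫ C.toHo.map b.hom ≫ C.toHo.map g := by
          rw [e1, CategoryTheory.Functor.map_id, Category.id_comp]
      _ = C.toHo.map f ≫ (C.toHo.map p.fst ≫ C.toHo.map b.hom) ≫ C.toHo.map g := by
          simp only [Category.assoc]
      _ = C.toHo.map f ≫ C.toHo.map a.hom ≫ C.toHo.map p.snd ≫ C.toHo.map g := by
          rw [← e3, Category.assoc]
      _ = _ := by rw [e2, CategoryTheory.Functor.map_id, Category.comp_id]
  obtain ⟨β, hβ1, hβ2⟩ := MoorePath.exists_of_joined hj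
  let q : PathHom b a := PathHom.mk f g β hβ1 hβ2
  have i1 : IsIso (pathHo p ≫ pathHo q) := by
    rw [← pathHo_comp]
    exact isIso_pathHo_of_joined_id _ hf1 hg1
  have i2 : IsIso (pathHo q ≫ pathHo p) := by
    rw [← pathHo_comp]
    exact isIso_pathHo_of_joined_id _ hf2 hg2
  -- The composites are only known to be invertible, not identities: one yields a section of `pathHo
  -- p`, the other shows it is a monomorphism.
  have : IsSplitEpi (pathHo p) := ⟨⟨⟨inv (pathHo q ≫ pathHo p) ≫ pathHo q, by simp⟩⟩⟩
  have : Mono (pathHo p) := mono_of_mono (pathHo p) (pathHo q)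
  exact (isIso_of_mono_of_isSplitEpi (pathHo p) :)

/-! ### The inclusion is a weak equivalence -/

namespace PathHom

/-- The deformation of the mapping spaces of `P(C)` between identities, which removes initial
segments of the Moore paths. -/
def slide {x y : C.Obj} (p : PathHom (constObj x) (constObj y)) (s : ℝ≥0) :
    PathHom (constObj x) (constObj y) :=
  -- Since the objects are identities, the second component equals the starting point of the Moore
  -- path, so it has to move along with it.
  mk p.fst (p.moore.path s) (p.moore.drop s)
    ((MoorePath.drop_source _ _).trans (Category.id_comp (p.moore.path s)).symm)
    ((MoorePath.drop_target _ _).trans p.moore_target)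

theorem slide_zero {x y : C.Obj} (p : PathHom (constObj x) (constObj y)) : p.slide 0 = p :=
  ext rfl (p.moore_source.trans (Category.id_comp p.snd)) (MoorePath.drop_zero _)

theorem slide_length {x y : C.Obj} (p : PathHom (constObj x) (constObj y)) :
    p.slide p.moore.length = constHom p.fst := by
  have h : p.moore.target = p.fst := p.moore_target.trans (Category.comp_id p.fst)
  exact ext rfl h ((MoorePath.drop_length _).trans (congrArg MoorePath.const h))

theorem constHom_slide {x y : C.Obj} (f : x ⟶ y) (s : ℝ≥0) :
    (constHom f).slide s = constHom f :=
  ext rfl rfl (MoorePath.const_drop _ _)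

theorem continuous_slide {x y : C.Obj} :
    Continuous fun p : PathHom (constObj x) (constObj y) × ℝ≥0 => p.1.slide p.2:= by
  have h := continuous_iff.1 (_root_.continuous_fst :
    Continuous (Prod.fst : PathHom (constObj x) (constObj y) × ℝ≥0 → _))
  exact continuous_iff.2 ⟨h.1,
    (MoorePath.continuous_iff.1 (continuous_moore (a := constObj x) (b := constObj y))).1,
    MoorePath.continuous_drop h.2.2 _root_.continuous_snd⟩

end PathHom

theorem isWeakHomotopyEquiv_inclusion (x y : C.Obj) :
    IsWeakHomotopyEquiv ((inclusion.app C).mapSpace x y) := by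
  let P := PathHom (constObj x) (constObj y)
  let i : C(x ⟶ y, KSpace P) := (inclusion.app C).mapSpace x y
  let r : C(KSpace P, x ⟶ y) :=
    ⟨fun p => (unK p).fst, PathHom.continuous_fst.comp continuous_unK⟩
  -- Time is scaled by the length of each path, so that at time one exactly the whole path is
  -- erased.
  have hH : Continuous fun z : P × I =>
      PathHom.slide z.1 (MoorePath.unitLength z.2 * z.1.moore.length) := by
    refine PathHom.continuous_slide.comp (continuous_fst.prodMk ?_)
    exact (MoorePath.unitLength.continuous.comp continuous_snd).mul
      ((MoorePath.continuous_iff.1 PathHom.continuous_moore).2.comp continuous_fst)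
  refine isWeakHomotopyEquiv_of_deformationRetract i r ⟨_, hH⟩ (fun f => rfl) (fun p => ?_)
    (fun p => ?_) (fun f t => PathHom.constHom_slide f _)
  · change PathHom.slide p (MoorePath.unitLength 0 * _) = p
    rw [MoorePath.unitLength_zero, zero_mul, PathHom.slide_zero]
  · change PathHom.slide (unK p) (MoorePath.unitLength 1 * _) = constHom (unK p).fst
    rw [MoorePath.unitLength_one, one_mul, PathHom.slide_length]

theorem isDwyerKanEquiv_inclusion (C : CatTop.{u}) : IsDwyerKanEquiv (inclusion.app C) := by
  refine ⟨isWeakHomotopyEquiv_inclusion, Hom.ho_isEquivalence _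
    (fun x y => (isWeakHomotopyEquiv_inclusion x y).1) fun (a : C.PathObj) => ?_⟩
  -- Every object `a` is reached from the identity of its source; the components `𝟙` and `a.hom` are
  -- weak equivalences.
  let p : PathHom (constObj a.src) a := PathHom.mk (𝟙 _) a.hom (MoorePath.const a.hom)
    (Category.id_comp a.hom).symm (Category.id_comp a.hom).symm
  exact ⟨a.src, (toK p : constObj a.src ⟶ a),
    isWeakEquiv_path p (C.isWeakEquiv_id _) a.isWeakEquiv⟩

/-! ### The evaluation is a fibration -/

/-- `transport` along the two components of the given homotopy is the lift, and `transport_zero` is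
its initial condition. The cube plays no role except that cube times interval is compactly
generated. -/
theorem isSerreFibration_endpoints (a b : C.PathObj) :
    IsSerreFibration (⟨fun p => toK ((unK p).fst, (unK p).snd),
      continuous_toK_comp ((PathHom.continuous_fst.prodMk PathHom.continuous_snd).comp
        continuous_unK)⟩ :
      C(KSpace (PathHom a b), KSpace ((a.src ⟶ b.src) × (a.tgt ⟶ b.tgt)))) := by
  intro n f H hH
  let f' : (Fin n → I) → PathHom a b := fun x => unK (Y := PathHom a b) (f x)
  let H' : (Fin n → I) × I → (a.src ⟶ b.src) × (a.tgt ⟶ b.tgt) := fun z =>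
    unK (Y := (a.src ⟶ b.src) × (a.tgt ⟶ b.tgt)) (H z)
  have hf' : Continuous f' := continuous_unK.comp f.continuous
  have hH' : Continuous H' := continuous_unK.comp H.continuous
  have h0 : ∀ x, H' (x, 0) = ((f' x).fst, (f' x).snd) := hH
  let F (x : Fin n → I) : C(I, a.src ⟶ b.src) := ⟨fun s => (H' (x, s)).1, by fun_prop⟩
  let G (x : Fin n → I) : C(I, a.tgt ⟶ b.tgt) := ⟨fun s => (H' (x, s)).2, by fun_prop⟩
  have hF (x) : F x 0 = (f' x).fst := congrArg Prod.fst (h0 x)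
  have hG (x) : G x 0 = (f' x).snd := congrArg Prod.snd (h0 x)
  have hL : Continuous fun z : (Fin n → I) × I =>
      (f' z.1).transport (F z.1) (G z.1) z.2 (hF z.1) (hG z.1) := by
    refine PathHom.continuous_transport (f := fun z => F z.1) (g := fun z => G z.1)
      (hf'.comp continuous_fst) ?_ ?_ continuous_snd _ _
    · exact (continuous_fst.comp hH').comp
        ((continuous_fst.comp continuous_fst).prodMk continuous_snd)
    · exact (continuous_snd.comp hH').comp
        ((continuous_fst.comp continuous_fst).prodMk continuous_snd)
  exact ⟨⟨fun z => toK _, continuous_toK_comp hL⟩,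
    fun x => congrArg toK (PathHom.transport_zero _ _ _ _ _), fun z => rfl⟩

theorem isFibration_evaluation (C : CatTop.{u}) : IsFibration (evaluation.app C) := by
  refine ⟨isSerreFibration_endpoints, ?_⟩
  intro (a : C.PathObj) (b : ProdObj C C) e he
  have hf : C.IsWeakEquiv (unK e).1 := he.map (C.prodFst C)
  have hg : C.IsWeakEquiv (unK e).2 := he.map (C.prodSnd C)
  obtain ⟨k, hk, hk1, -⟩ := hf.exists_inverse
  have hj : Joined (a.hom ≫ (unK e).2) ((unK e).1 ≫ k ≫ a.hom ≫ (unK e).2) := by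
    have := (hk1.map (C.postcomp a.src (a.hom ≫ (unK e).2)).continuous).symm
    change Joined (𝟙 a.src ≫ a.hom ≫ (unK e).2) (((unK e).1 ≫ k) ≫ a.hom ≫ (unK e).2) at this
    rw [Category.id_comp] at this
    exact (Category.assoc (unK e).1 k (a.hom ≫ (unK e).2)) ▸ this
  obtain ⟨α, h1, h2⟩ := MoorePath.exists_of_joined hj
  -- Conjugating `a` by the components of `e`, with a homotopy inverse `k` of the first, gives an
  -- object strictly over `b`; the contraction of `(unK e).1 ≫ k` fills the square.
  let a' : C.PathObj := ⟨b.fst, b.snd, k ≫ a.hom ≫ (unK e).2, hk.comp (a.isWeakEquiv.comp hg)⟩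
  let p : PathHom a a' := PathHom.mk (unK e).1 (unK e).2 α h1 h2
  exact ⟨a', (toK p : a ⟶ a'), rfl, isWeakEquiv_path p hf hg, Category.comp_id e⟩

/-! ### Fibrations and isomorphisms -/

/-- Lifting problems against the composite are carried back along `e.inv`. Being inverse is an
equality of functors, hence the correction by `eqToHom` on morphisms. This serves to change the
model of the product `C × C`. -/
theorem IsFibration.comp_iso {C D E : CatTop.{u}} {F : C ⟶ D} (hF : IsFibration F) (e : D ≅ E) :
    IsFibration (F ≫ e.hom) := by
  have h1 : e.hom.functor ⋙ e.inv.functor = 𝟭 D.Obj := congrArg Hom.functor e.hom_inv_id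
  have h2 : e.inv.functor ⋙ e.hom.functor = 𝟭 E.Obj := congrArg Hom.functor e.inv_hom_id
  have o1 (x : D.Obj) : e.inv.functor.obj (e.hom.functor.obj x) = x := Functor.congr_obj h1 x
  have o2 (x : E.Obj) : e.hom.functor.obj (e.inv.functor.obj x) = x := Functor.congr_obj h2 x
  have m1 {x y : D.Obj} (f : x ⟶ y) : e.inv.functor.map (e.hom.functor.map f) =
    eqToHom (o1 x) ≫ f ≫ eqToHom (o1 y).symm := Functor.congr_hom h1 f
  have m2 {x y : E.Obj} (f : x ⟶ y) : e.hom.functor.map (e.inv.functor.map f) =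
    eqToHom (o2 x) ≫ f ≫ eqToHom (o2 y).symm := Functor.congr_hom h2 f
  refine ⟨fun x y n f H hH => ?_, fun a b w hw => ?_⟩
  -- The inverse of `e.hom` on this mapping space; it is continuous because composing with a fixed
  -- morphism is.
  · let K : C(e.hom.functor.obj (F.functor.obj x) ⟶ e.hom.functor.obj (F.functor.obj y),
        F.functor.obj x ⟶ F.functor.obj y) :=
      ((D.precomp (eqToHom (o1 _).symm) _).comp (D.postcomp _ (eqToHom (o1 _)))).comp
        (Hom.mapSpace e.inv _ _)
    have hK (g) : K g = eqToHom (o1 _).symm ≫ e.inv.functor.map g ≫ eqToHom (o1 _) := rfl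
    obtain ⟨L, hL0, hL⟩ := hF.1 x y n f (K.comp H) fun z => by
      change K (H (z, 0)) = F.functor.map (f z)
      rw [hH z, hK]
      change _ ≫ e.inv.functor.map (e.hom.functor.map (F.functor.map (f z))) ≫ _ = _
      simp [m1]
    refine ⟨L, hL0, fun z => ?_⟩
    change e.hom.functor.map (F.functor.map (L z)) = H z
    have : F.functor.map (L z) = K (H z) := hL z
    rw [this, hK]
    simp [m2, eqToHom_map]
  · let k : F.functor.obj a ⟶ e.inv.functor.obj b :=
      eqToHom (o1 _).symm ≫ e.inv.functor.map w
    obtain ⟨a', d, h, hd, hdk⟩ := hF.2 a _ k ((isWeakEquiv_eqToHom _).comp (hw.map e.inv))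
    refine ⟨a', d, (congrArg e.hom.functor.obj h).trans (o2 b), hd, ?_⟩
    change e.hom.functor.map (F.functor.map d) ≫ _ = w
    have : F.functor.map d = k ≫ eqToHom h.symm := by simp [← hdk]
    rw [this]
    simp [k, m2, eqToHom_map]

/-- The map `p` lands in the chosen product `C ⨯ C`; it is the evaluation followed by the canonical
isomorphism from the explicit product. -/
theorem fibration_prepathObject_p (C : CatTop.{u}) : Fibration (prepathObject C).p := by
  let e : C.prod C ≅ C ⨯ C :=
    (prodIsLimit C C).conePointUniqueUpToIso (Limits.limit.isLimit _)
  have h : (prepathObject C).p = evaluation.app C ≫ e.hom := by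
    refine Limits.prod.hom_ext ?_ ?_
    · have he : e.hom ≫ Limits.prod.fst = C.prodFst C :=
        (prodIsLimit C C).conePointUniqueUpToIso_hom_comp _ ⟨Limits.WalkingPair.left⟩
      exact (PrepathObject.p_fst _).trans (congrArg (evaluation.app C ≫ ·) he).symm
    · have he : e.hom ≫ Limits.prod.snd = C.prodSnd C :=
        (prodIsLimit C C).conePointUniqueUpToIso_hom_comp _ ⟨Limits.WalkingPair.right⟩
      exact (PrepathObject.p_snd _).trans (congrArg (evaluation.app C ≫ ·) he).symm
  rw [h]
  exact ⟨(isFibration_evaluation C).comp_iso e⟩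

/-! ### The pullback square -/

theorem isPullback_pathMapSpace (a b : C.PathObj) :
    IsPullback (toMoore a b) (toEndpoints a b) (mooreEnds a b) (whisker a b) := by
  have w : toMoore a b ≫ mooreEnds a b = toEndpoints a b ≫ whisker a b := by
    ext p
    exact congrArg toK (Prod.ext (unK p).moore_source (unK p).moore_target)
  let m (s : Limits.PullbackCone (mooreEnds a b) (whisker a b)) :
      C(s.pt, KSpace (MoorePath (a.src ⟶ b.tgt))) := ConcreteCategory.hom s.fst
  let e (s : Limits.PullbackCone (mooreEnds a b) (whisker a b)) :
      C(s.pt, KSpace ((a.src ⟶ b.src) × (a.tgt ⟶ b.tgt))) := ConcreteCategory.hom s.snd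
  have hc (s : Limits.PullbackCone (mooreEnds a b) (whisker a b))
      (z : s.pt) := ConcreteCategory.congr_hom s.condition z
  let l (s : Limits.PullbackCone (mooreEnds a b) (whisker a b)) (z : s.pt) : PathHom a b :=
    PathHom.mk (unK (e s z)).1 (unK (e s z)).2 (unK (m s z))
      (congrArg Prod.fst (congrArg unK (hc s z))) (congrArg Prod.snd (congrArg unK (hc s z)))
  -- The cone point is compactly generated, so continuity reduces to that of the three components in
  -- the ordinary subspace topology.
  have hl (s) : Continuous fun z => (toK (l s z) : KSpace (PathHom a b)) := by
    have c1 := continuous_unK.comp (m s).continuous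
    have c2 := continuous_unK.comp (e s).continuous
    exact continuous_toK_comp (PathHom.continuous_iff.2
      ⟨continuous_fst.comp c2, continuous_snd.comp c2, c1⟩)
  let L (s : Limits.PullbackCone (mooreEnds a b) (whisker a b)) :
      C(s.pt, KSpace (PathHom a b)) := ⟨_, hl s⟩
  refine ⟨⟨w⟩, ⟨Limits.PullbackCone.IsLimit.mk w
    (fun s => (ConcreteCategory.ofHom (L s) : s.pt ⟶ pathMapSpace a b))
    (fun s => rfl) (fun s => rfl) fun s f h1 h2 => ?_⟩⟩
  ext z
  have e1 := ConcreteCategory.congr_hom h1 z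
  have e2 := congrArg (unK (Y := (a.src ⟶ b.src) × (a.tgt ⟶ b.tgt)))
    (ConcreteCategory.congr_hom h2 z)
  exact congrArg (toK (Y := PathHom a b)) (PathHom.ext (congrArg Prod.fst e2) (congrArg Prod.snd e2)
    (congrArg (unK (Y := MoorePath (a.src ⟶ b.tgt))) e1))

end CatTop

end

theorem mainTheorem2 :
    (CatTop.inclusion.{u} ≫ CatTop.evaluation.{u} = CatTop.diagonal.{u}) ∧
    ∀ C : CatTop.{u},
      (∀ a b : C.PathObj,
        IsPullback (CatTop.toMoore a b) (CatTop.toEndpoints a b)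
          (CatTop.mooreEnds a b) (CatTop.whisker a b)) ∧
      WeakEquivalence (CatTop.inclusion.app C) ∧
      Fibration (CatTop.evaluation.app C) ∧
      ∃ Q : PathObject C, Q.toPrepathObject = CatTop.prepathObject C ∧ Q.IsGood := by
  refine ⟨rfl, fun C => ⟨CatTop.isPullback_pathMapSpace, ⟨CatTop.isDwyerKanEquiv_inclusion C⟩,
    ⟨CatTop.isFibration_evaluation C⟩, ?_⟩⟩
  exact ⟨{ CatTop.prepathObject C with
      weakEquivalence_ι := ⟨CatTop.isDwyerKanEquiv_inclusion C⟩ }, rfl,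
    ⟨CatTop.fibration_prepathObject_p C⟩⟩
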